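/- Let $\mathcal M$ be the set of (a.e. classes of) complex-valued or extended real-valued Lebesgue measurable functions on $\mathbb R^n$ and $\mathcal M^+$ the set of those that are non-negative a.e. A \emph{function quasi-norm} is a map $\rho:\mathcal M^+\to[0,\infty]$ for which there is a constant $C\in[1,\infty)$ such that for all $f,g,f_k\in\mathcal M^+$, all $a\ge 0$ and all measurable $E$: (P1) $\rho(f)=0$ if and only if $f=0$ a.e., $\rho(af)=a\rho(f)$, $\rho(f+g)\le C(\rho(f)+\rho(g))$; (P2) $g\le f$ a.e. implies $\rho(g)\le\rho(f)$; (P3) $f_k\uparrow f$ a.e. implies $\rho(f_k)\uparrow\rho(f)$; (P4) $|E|<\infty$ implies $\rho(\chi_E)<\infty$. The corresponding \emph{quasi-Banach function space} (q-BFS) is $X(\rho)=\{f\in\mathcal M:\ \|f\|_{X(\rho)}:=\rho(|f|)<\infty\}$, with the topology given by its quasi-norm. If $C=1$ is admissible and, in addition, (P5) for every measurable $E$ with $|E|<\infty$ there is $c_E\in(0,\infty)$ with $\int_E f\,dx\le c_E\,\rho(f)$ for all $f\in\mathcal M^+$, then $X(\rho)$ is a \emph{Banach function space} (BFS). The q-BFS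 $X(\rho)$ is \emph{rearrangement-invariant} if $\rho(f)=\rho(g)$ whenever $f,g\in\mathcal M^+$ are finite a.e. and equimeasurable. Two such spaces \emph{coincide} if they are equal as sets and their quasi-norms are equivalent. $X(\rho)$ is a \emph{power q-BFS} if there is $b\in(0,1]$ such that $X(\sigma)$, where $\sigma(f)=\big(\rho(f^{1/b})\big)^b$, coincides with a BFS. Let $L=L(\mathbb R^n)$ be a power q-BFS. Let $C_0(\mathbb R^n)$ be the set of continuous functions with compact support, and let $\overline{C_0(\mathbb R^n)}$ be its closure in $L$. Let $L_a$ be the set of all $f\in L$ such that $\|f\chi_{E_k}\|_L\to 0$ for every sequence of measurable sets $E_k$ with $\chi_{E_k}\to 0$ a.e. A set $K\subset L$ is \emph{precompact} in $L$ if its closure in $L$ is compact. For $K\subset L$ consider the conditions (i) $K$ is bounded in $L$; (ii) for every $\varepsilon>0$ there is a compact set $G\subset\mathbb R^n$ such that $\|u\chi_{\mathbb R^n\setminus G}\|_L<\varepsilon$ for all $u\in K$; (iii) for every $\varepsilon>0$ there is $\delta>0$ such that $\|u(\cdot+h)-u\|_L<\varepsilon$ for all $u\in K$ and all $h\in\mathbb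 R^n$ with $|h|<\delta$. (a) If $L$ coincides with a rearrangement-invariant q-BFS and $K\subset\overline{C_0(\mathbb R^n)}$ is precompact in $L$, then $K$ satisfies (i)--(iii). (b) Conversely, if $K\subset L_a$ satisfies (i)--(iii), then $K$ is precompact in $L$. -/

import Mathlib

open MeasureTheory Filter Topology
open scoped ENNReal NNReal

noncomputable section

/-- A function quasi-norm over `(α, μ)`: a map `ρ : M⁺(α, μ) → [0, ∞]` with properties (P1)-(P4).
`M⁺(α, μ)` is the class of `μ`-measurable functions with values in `[0, ∞]`; the values of `toFun`
outside that class are irrelevant. -/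
structure FunctionQuasiNorm {α : Type*} [MeasurableSpace α] (μ : Measure α) where
  toFun : (α → ℝ≥0∞) → ℝ≥0∞
  eq_zero_iff' : ∀ f : α → ℝ≥0∞, AEMeasurable f μ → (toFun f = 0 ↔ f =ᵐ[μ] 0)
  smul' : ∀ (a : ℝ≥0) (f : α → ℝ≥0∞), AEMeasurable f μ →
    toFun (fun x => (a : ℝ≥0∞) * f x) = (a : ℝ≥0∞) * toFun f
  exists_add_le' : ∃ C : ℝ≥0, 1 ≤ C ∧ ∀ f g : α → ℝ≥0∞, AEMeasurable f μ → AEMeasurable g μ →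
    toFun (fun x => f x + g x) ≤ C * (toFun f + toFun g)
  mono' : ∀ f g : α → ℝ≥0∞, AEMeasurable f μ → AEMeasurable g μ → g ≤ᵐ[μ] f → toFun g ≤ toFun f
  tendsto' : ∀ (f : ℕ → α → ℝ≥0∞) (g : α → ℝ≥0∞), (∀ k, AEMeasurable (f k) μ) →
    AEMeasurable g μ → (∀ᵐ x ∂μ, Monotone fun k => f k x) →
    (∀ᵐ x ∂μ, Tendsto (fun k => f k x) atTop (𝓝 (g x))) →
    Tendsto (fun k => toFun (f k)) atTop (𝓝 (toFun g))
  indicator_lt_top' : ∀ E : Set α, NullMeasurableSet E μ → μ E < ∞ →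
    toFun (E.indicator fun _ => 1) < ∞

namespace FunctionQuasiNorm

variable {α : Type*} [MeasurableSpace α] {μ : Measure α}

/-- The quasi-norm `‖u‖_X = ρ(|u|) ∈ [0, ∞]` of a complex function. -/
def qnorm (ρ : FunctionQuasiNorm μ) (u : α → ℂ) : ℝ≥0∞ :=
  ρ.toFun fun x => ‖u x‖ₑ

theorem toFun_congr (ρ : FunctionQuasiNorm μ) {f g : α → ℝ≥0∞} (hf : AEMeasurable f μ)
    (h : f =ᵐ[μ] g) : ρ.toFun f = ρ.toFun g :=
  le_antisymm (ρ.mono' _ _ (hf.congr h) hf h.le) (ρ.mono' _ _ hf (hf.congr h) h.symm.le)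

theorem aemeasurable_enorm_coe (f : α →ₘ[μ] ℂ) : AEMeasurable (fun x => ‖f x‖ₑ) μ :=
  f.aestronglyMeasurable.enorm

theorem qnorm_zero (ρ : FunctionQuasiNorm μ) : ρ.qnorm (0 : α →ₘ[μ] ℂ) = 0 := by
  refine (ρ.eq_zero_iff' _ (aemeasurable_enorm_coe _)).2 ?_
  filter_upwards [AEEqFun.coeFn_zero (α := α) (β := ℂ) (μ := μ)] with x hx
  simp [hx]

theorem exists_qnorm_add_le (ρ : FunctionQuasiNorm μ) : ∃ C : ℝ≥0, 1 ≤ C ∧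
    ∀ f g : α →ₘ[μ] ℂ, ρ.qnorm (f + g : α →ₘ[μ] ℂ) ≤ C * (ρ.qnorm f + ρ.qnorm g) := by
  obtain ⟨C, hC, h⟩ := ρ.exists_add_le'
  refine ⟨C, hC, fun f g => le_trans (ρ.mono' _ _ ?_ (aemeasurable_enorm_coe _) ?_)
    (h _ _ (aemeasurable_enorm_coe f) (aemeasurable_enorm_coe g))⟩
  · exact (aemeasurable_enorm_coe f).add (aemeasurable_enorm_coe g)
  · filter_upwards [AEEqFun.coeFn_add f g] with x hx
    simpa [hx] using enorm_add_le (f x) (g x)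

theorem qnorm_smul (ρ : FunctionQuasiNorm μ) (c : ℂ) (f : α →ₘ[μ] ℂ) :
    ρ.qnorm (c • f : α →ₘ[μ] ℂ) = ‖c‖ₑ * ρ.qnorm f := by
  refine Eq.trans (ρ.toFun_congr (aemeasurable_enorm_coe _) ?_)
    (ρ.smul' ‖c‖₊ _ (aemeasurable_enorm_coe f))
  filter_upwards [AEEqFun.coeFn_smul c f] with x hx
  simp [hx, enorm_eq_nnnorm]

/-- The quasi-Banach function space `X(ρ)` of all (classes of) `μ`-measurable functions `f` with
`‖f‖_X = ρ(|f|) < ∞`. By (P1) and (P2) a function with `ρ(|f|) < ∞` is finite almost everywhere, so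
all elements are classes of complex-valued functions. -/
def space (ρ : FunctionQuasiNorm μ) : Submodule ℂ (α →ₘ[μ] ℂ) where
  carrier := {f | ρ.qnorm f < ∞}
  zero_mem' := by simp [ρ.qnorm_zero]
  add_mem' := by
    intro f g hf hg
    obtain ⟨C, -, h⟩ := ρ.exists_qnorm_add_le
    exact (h f g).trans_lt (ENNReal.mul_lt_top ENNReal.coe_lt_top (ENNReal.add_lt_top.2 ⟨hf, hg⟩))
  smul_mem' := by
    intro c f hf
    simpa only [Set.mem_ofPred_eq, ρ.qnorm_smul] using ENNReal.mul_lt_top enorm_lt_top hf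

theorem mem_space (ρ : FunctionQuasiNorm μ) (f : α →ₘ[μ] ℂ) :
    f ∈ ρ.space ↔ ρ.qnorm f < ∞ := Iff.rfl

/-- The entourages `{(f, g) | ‖f - g‖_X < ε}`, `ε > 0`, of `X(ρ)`. -/
def entourageBasis (ρ : FunctionQuasiNorm μ) : FilterBasis (ρ.space × ρ.space) where
  sets := {V | ∃ ε : ℝ≥0∞, 0 < ε ∧
    V = {p | ρ.qnorm ((p.1 - p.2 : ρ.space) : α →ₘ[μ] ℂ) < ε}}
  nonempty := ⟨_, 1, one_pos, rfl⟩
  inter_sets := by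
    rintro _ _ ⟨a, ha, rfl⟩ ⟨b, hb, rfl⟩
    refine ⟨_, ⟨min a b, lt_min ha hb, rfl⟩, fun p hp => ?_⟩
    simpa only [Set.mem_inter_iff, Set.mem_ofPred_eq, lt_min_iff] using hp

/-- The uniform structure (and hence the topology) of `X(ρ)` given by the quasi-norm. -/
instance instUniformSpaceSpace (ρ : FunctionQuasiNorm μ) : UniformSpace ρ.space :=
  UniformSpace.ofCore <| UniformSpace.Core.mkOfBasis ρ.entourageBasis
    (by
      rintro _ ⟨ε, hε, rfl⟩ f
      simpa [ρ.qnorm_zero] using hε)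
    (by
      rintro _ ⟨ε, hε, rfl⟩
      refine ⟨_, ⟨ε, hε, rfl⟩, fun p hp => ?_⟩
      have h := ρ.qnorm_smul (-1) ((p.1 - p.2 : ρ.space) : α →ₘ[μ] ℂ)
      have e : (-1 : ℂ) • ((p.1 - p.2 : ρ.space) : α →ₘ[μ] ℂ)
          = ((p.2 - p.1 : ρ.space) : α →ₘ[μ] ℂ) :=
        (neg_one_smul ℂ ((p.1 - p.2 : ρ.space) : α →ₘ[μ] ℂ)).trans (by simp)
      rw [e] at h
      simp only [Set.mem_preimage, Set.mem_ofPred_eq, Prod.fst_swap, Prod.snd_swap] at hp ⊢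
      rw [h]
      simpa using hp)
    (by
      rintro _ ⟨ε, hε, rfl⟩
      obtain ⟨C, hC, h⟩ := ρ.exists_qnorm_add_le
      have hC0 : (C : ℝ≥0∞) ≠ 0 := by
        simpa using (zero_lt_one.trans_le hC).ne'
      refine ⟨_, ⟨ε / C / 2, ENNReal.half_pos (ENNReal.div_pos hε.ne' ENNReal.coe_ne_top).ne',
        rfl⟩, ?_⟩
      rintro ⟨f, g⟩ ⟨k, h1, h2⟩
      have e : ((f - g : ρ.space) : α →ₘ[μ] ℂ)
          = ((f - k : ρ.space) : α →ₘ[μ] ℂ) + ((k - g : ρ.space) : α →ₘ[μ] ℂ) := by simp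
      simp only [Set.mem_ofPred_eq] at h1 h2 ⊢
      rw [e]
      refine (h _ _).trans_lt ?_
      calc (C : ℝ≥0∞) * _ < C * (ε / C / 2 + ε / C / 2) :=
            ENNReal.mul_lt_mul_right hC0 ENNReal.coe_ne_top (ENNReal.add_lt_add h1 h2)
        _ = ε := by rw [ENNReal.add_halves, ENNReal.mul_div_cancel hC0 ENNReal.coe_ne_top])

/-- `X(ρ)` and `X(σ)` coincide: they consist of the same functions and their quasi-norms are
equivalent. -/
def Coincides (ρ σ : FunctionQuasiNorm μ) : Prop :=
  ρ.space = σ.space ∧ ∃ c₁ c₂ : ℝ≥0, 0 < c₁ ∧ 0 < c₂ ∧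
    ∀ f ∈ ρ.space, ρ.qnorm f ≤ c₁ * σ.qnorm f ∧ σ.qnorm f ≤ c₂ * ρ.qnorm f

/-- `ρ` is a function norm, i.e. `X(ρ)` is a Banach function space: the triangle inequality holds
with constant `1`, and (P5) holds. -/
def IsFunctionNorm (ρ : FunctionQuasiNorm μ) : Prop :=
  (∀ f g : α → ℝ≥0∞, AEMeasurable f μ → AEMeasurable g μ →
    ρ.toFun (fun x => f x + g x) ≤ ρ.toFun f + ρ.toFun g) ∧
  ∀ E : Set α, NullMeasurableSet E μ → μ E < ∞ → ∃ c : ℝ≥0, 0 < c ∧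
    ∀ f : α → ℝ≥0∞, AEMeasurable f μ → ∫⁻ x in E, f x ∂μ ≤ c * ρ.toFun f

/-- `ρ` is rearrangement-invariant: it takes the same value on equimeasurable functions that are
finite almost everywhere. -/
def IsRearrangementInvariant (ρ : FunctionQuasiNorm μ) : Prop :=
  ∀ f g : α → ℝ≥0∞, AEMeasurable f μ → AEMeasurable g μ →
    (∀ᵐ x ∂μ, f x < ∞) → (∀ᵐ x ∂μ, g x < ∞) →
    (∀ t : ℝ≥0, μ {x | (t : ℝ≥0∞) < f x} = μ {x | (t : ℝ≥0∞) < g x}) → ρ.toFun f = ρ.toFun g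

/-- The function quasi-norm `σ(f) = ρ(f^(1/b))^b`, whose space is `X(ρ)^b`. -/
def power (ρ : FunctionQuasiNorm μ) (b : ℝ) (hb : 0 < b) : FunctionQuasiNorm μ where
  toFun f := (ρ.toFun fun x => f x ^ (1 / b)) ^ b
  eq_zero_iff' f hf := by
    have h1 : (0 : ℝ) < 1 / b := by positivity
    rw [ENNReal.rpow_eq_zero_iff_of_pos hb, ρ.eq_zero_iff' _ (hf.pow_const _)]
    refine eventually_congr (Eventually.of_forall fun x => ?_)
    simp [ENNReal.rpow_eq_zero_iff_of_pos (inv_pos.2 hb)]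
  smul' a f hf := by
    have h1 : (0 : ℝ) ≤ 1 / b := by positivity
    have e : (fun x => ((a : ℝ≥0∞) * f x) ^ (1 / b))
        = fun x => ((a ^ (1 / b) : ℝ≥0) : ℝ≥0∞) * f x ^ (1 / b) := by
      funext x
      rw [ENNReal.mul_rpow_of_nonneg _ _ h1, ENNReal.coe_rpow_of_nonneg _ h1]
    rw [e, ρ.smul' _ _ (hf.pow_const _), ENNReal.mul_rpow_of_nonneg _ _ hb.le,
      ENNReal.coe_rpow_of_nonneg _ h1, ← ENNReal.rpow_mul, one_div_mul_cancel hb.ne',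
      ENNReal.rpow_one]
  exists_add_le' := by
    obtain ⟨C, hC, h⟩ := ρ.exists_add_le'
    have h1 : (0 : ℝ) ≤ 1 / b := by positivity
    have key : ∀ (p : ℝ), 0 ≤ p → ∀ s t : ℝ≥0∞, (s + t) ^ p ≤ 2 ^ p * (s ^ p + t ^ p) := by
      intro p hp s t
      have hm : s + t ≤ 2 * max s t := by
        rw [two_mul]
        exact add_le_add (le_max_left _ _) (le_max_right _ _)
      refine (ENNReal.rpow_le_rpow hm hp).trans ?_
      rw [ENNReal.mul_rpow_of_nonneg _ _ hp]
      refine mul_le_mul_right ?_ _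
      rcases le_total s t with hst | hst
      · rw [max_eq_right hst]
        exact le_add_self
      · rw [max_eq_left hst]
        exact le_self_add
    have one_le_two_rpow : ∀ p : ℝ, 0 ≤ p → (1 : ℝ≥0) ≤ 2 ^ p := fun p hp =>
      NNReal.one_le_rpow one_le_two hp
    refine ⟨(2 ^ (1 / b) * C) ^ b * 2 ^ b, ?_, fun f g hf hg => ?_⟩
    · exact one_le_mul (NNReal.one_le_rpow (one_le_mul (one_le_two_rpow _ h1) hC) hb.le)
        (one_le_two_rpow _ hb.le)
    · have hf' := hf.pow_const (1 / b)
      have hg' := hg.pow_const (1 / b)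
      have hle : ρ.toFun (fun x => (f x + g x) ^ (1 / b)) ≤ ((2 ^ (1 / b) * C : ℝ≥0) : ℝ≥0∞) *
          (ρ.toFun (fun x => f x ^ (1 / b)) + ρ.toFun (fun x => g x ^ (1 / b))) := by
        have hs := ρ.smul' (2 ^ (1 / b)) _ (hf'.add hg')
        refine (ρ.mono' (fun x => ((2 ^ (1 / b) : ℝ≥0) : ℝ≥0∞) *
          (f x ^ (1 / b) + g x ^ (1 / b))) _ ((hf'.add hg').const_mul _)
          ((hf.add hg).pow_const _) (Eventually.of_forall fun x => ?_)).trans ?_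
        · have := key _ h1 (f x) (g x)
          simpa only [ENNReal.coe_rpow_of_nonneg _ h1, ENNReal.coe_ofNat, Pi.add_apply] using this
        · refine hs.le.trans ?_
          rw [ENNReal.coe_mul, mul_assoc]
          exact mul_le_mul_right (h _ _ hf' hg') _
      refine (ENNReal.rpow_le_rpow hle hb.le).trans ?_
      rw [ENNReal.mul_rpow_of_nonneg _ _ hb.le, ENNReal.coe_mul ((2 ^ (1 / b) * C) ^ b),
        ENNReal.coe_rpow_of_nonneg _ hb.le, ENNReal.coe_rpow_of_nonneg _ hb.le, mul_assoc]
      exact mul_le_mul_right (key _ hb.le _ _) _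
  mono' f g hf hg hfg := by
    have h1 : (0 : ℝ) ≤ 1 / b := by positivity
    refine ENNReal.rpow_le_rpow (ρ.mono' _ _ (hf.pow_const _) (hg.pow_const _) ?_) hb.le
    filter_upwards [hfg] with x hx
    exact ENNReal.rpow_le_rpow hx h1
  tendsto' f g hf hg hm ht := by
    have h1 : (0 : ℝ) ≤ 1 / b := by positivity
    refine (ENNReal.continuous_rpow_const.tendsto _).comp
      (ρ.tendsto' _ _ (fun k => (hf k).pow_const _) (hg.pow_const _) ?_ ?_)
    · filter_upwards [hm] with x hx
      exact fun i j hij => ENNReal.rpow_le_rpow (hx hij) h1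
    · filter_upwards [ht] with x hx
      exact (ENNReal.continuous_rpow_const.tendsto _).comp hx
  indicator_lt_top' E hE hμ := by
    have h1 : (0 : ℝ) < 1 / b := by positivity
    have e : (fun x => (E.indicator (fun _ => (1 : ℝ≥0∞)) x) ^ (1 / b))
        = E.indicator fun _ => 1 := by
      funext x
      by_cases hx : x ∈ E
      · simp [hx]
      · simp [hx, hb]
    rw [e]
    exact ENNReal.rpow_lt_top_of_nonneg hb.le (ρ.indicator_lt_top' E hE hμ).ne

/-- `X(ρ)` is a power quasi-Banach function space: for some `b ∈ (0, 1]`, the space `X(ρ)^b`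
coincides with a Banach function space. -/
def IsPower (ρ : FunctionQuasiNorm μ) : Prop :=
  ∃ (b : ℝ) (hb : 0 < b), b ≤ 1 ∧
    ∃ σ : FunctionQuasiNorm μ, σ.IsFunctionNorm ∧ (ρ.power b hb).Coincides σ

/-- The set `X_a` of functions with absolutely continuous quasi-norm: `‖f χ_{E_k}‖_X → 0` for every
sequence of `μ`-measurable sets `E_k` converging `μ`-a.e. to the empty set. -/
def acPart (ρ : FunctionQuasiNorm μ) : Set ρ.space :=
  {f | ∀ E : ℕ → Set α, (∀ k, NullMeasurableSet (E k) μ) → μ (⋂ k, ⋃ m ≥ k, E m) = 0 →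
    Tendsto (fun k => ρ.qnorm ((E k).indicator (f : α →ₘ[μ] ℂ))) atTop (𝓝 0)}

/-- The elements of `X(ρ)` that are (classes of) continuous functions with compact support. -/
def compactlySupported [TopologicalSpace α] (ρ : FunctionQuasiNorm μ) : Set ρ.space :=
  {f | ∃ φ : α → ℂ, Continuous φ ∧ HasCompactSupport φ ∧ (f : α →ₘ[μ] ℂ) =ᵐ[μ] φ}

/-- `K` is bounded in `X(ρ)`. -/
def IsBoundedIn (ρ : FunctionQuasiNorm μ) (K : Set ρ.space) : Prop :=
  ∃ M : ℝ≥0, ∀ u ∈ K, ρ.qnorm (u : α →ₘ[μ] ℂ) ≤ M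

/-- The functions in `K` have uniformly small quasi-norm outside compact sets. -/
def HasUniformlySmallTails [TopologicalSpace α] (ρ : FunctionQuasiNorm μ)
    (K : Set ρ.space) : Prop :=
  ∀ ε : ℝ≥0, 0 < ε → ∃ G : Set α, IsCompact G ∧
    ∀ u ∈ K, ρ.qnorm (Gᶜ.indicator (u : α →ₘ[μ] ℂ)) < ε

/-- `K` is uniformly mean continuous in `X(ρ)`: `‖u(· + h) - u‖_X` is small for small `h`, uniformly
in `u ∈ K`. -/
def IsUniformlyMeanContinuous {n : ℕ}
    (ρ : FunctionQuasiNorm (volume : Measure (EuclideanSpace ℝ (Fin n))))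
    (K : Set ρ.space) : Prop :=
  ∀ ε : ℝ≥0, 0 < ε → ∃ δ : ℝ, 0 < δ ∧ ∀ u ∈ K, ∀ h : EuclideanSpace ℝ (Fin n), ‖h‖ < δ →
    ρ.qnorm (fun x => (u : EuclideanSpace ℝ (Fin n) →ₘ[volume] ℂ) (x + h)
      - (u : EuclideanSpace ℝ (Fin n) →ₘ[volume] ℂ) x) < ε

/-- `K` is precompact in `X(ρ)`: its closure in `X(ρ)` is compact. -/
def IsPrecompactIn (ρ : FunctionQuasiNorm μ) (K : Set ρ.space) : Prop :=
  IsCompact (closure K)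

end FunctionQuasiNorm

end

/-!
Necessity of the three conditions rests on the total boundedness of a precompact set `K`. If `K`
lies in the closure of the continuous functions with compact support, then it has finite `ε`-nets
consisting of such functions (`exists_finite_net`), for which tails and translations are under
control; translates of the remainders `u - φ` are handled by the translation invariance of a
rearrangement-invariant quasi-norm (`IsRearrangementInvariant.toFun_translate`).

For sufficiency, choose `b ∈ (0, 1]` and a function norm `σ` with `ρ(|u|)^b ≈ σ(|u|^b)`
(`IsPower.exists_rpow_equiv`). As `|u + v|^b ≤ |u|^b + |v|^b`, the topology of `X(ρ)` is given by
the metric `σ(|u - v|^b)`, for which `X(ρ)` is complete (`IsPower.completeSpace`). It remains to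
see that `K` is totally bounded (`IsPower.totallyBounded`). If `b < 1`, elements of `X(ρ)` need
not be locally integrable and cannot be mollified. Instead, a compact set `G` carrying `K` up to
small tails is covered by finitely many balls of radius `δ`, and on each ball `u` is replaced by a
constant `c` nearly minimizing the mean of `|u - c|^b` over that ball. By minimality, at each
point `x` of the ball, `|u(x) - c|^b` is at most, up to a small error, twice the mean of `|u -
u(x)|^b` over the ball, hence a dimensional multiple of the mean of `|u(x + h) - u(x)|^b` over
`‖h‖ < 2δ` (`exists_step_approximation`). By Minkowski's integral inequality
(`IsFunctionNorm.toFun_lintegral_le`) the norm of this mean is at most the supremum over `‖h‖ <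
2δ` of `σ(|u(· + h) - u|^b)`, which is small by uniform mean continuity. The constants `c` are
bounded uniformly in `u ∈ K` since `σ` dominates integrals over balls, so they may be rounded to a
finite net, and finitely many step functions remain.

Minkowski's integral inequality follows from the triangle inequality for finite averages and
Fatou's lemma, without duality: by the strong law of large numbers a mean over `h` is the a.e.
limit of finite averages over random sample points.
-/

/-! ### Powers in `[0, ∞]` -/

theorem ENNReal.tsum_ne_top_of_tsum_rpow_ne_top {b : ℝ} (hb : 0 < b) (hb1 : b ≤ 1)
    {w : ℕ → ℝ≥0∞} (h : ∑' k, w k ^ b ≠ ∞) : ∑' k, w k ≠ ∞ := by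
  have hfin : ∀ m, (∑ k ∈ Finset.range m, w k) ^ b ≤ ∑ k ∈ Finset.range m, w k ^ b := fun m => by
    induction m with
    | zero => simp [hb]
    | succ m ih =>
      rw [Finset.sum_range_succ, Finset.sum_range_succ]
      exact (ENNReal.rpow_add_le_add_rpow _ _ hb.le hb1).trans (add_le_add ih le_rfl)
  refine ne_top_of_le_ne_top (ENNReal.rpow_ne_top_of_nonneg (inv_nonneg.2 hb.le) h)
    (ENNReal.tsum_le_of_sum_range_le fun m => ?_)
  rw [ENNReal.le_rpow_inv_iff hb]
  exact (hfin m).trans (ENNReal.sum_le_tsum _)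

theorem ENNReal.exists_forall_lt_mul_rpow_lt (c : ℝ≥0) {b : ℝ} (hb : 0 < b) {η : ℝ≥0∞}
    (hη : 0 < η) : ∃ ε : ℝ≥0∞, 0 < ε ∧ ∀ t < ε, c * t ^ b < η := by
  have h : Tendsto (fun t : ℝ≥0∞ => c * t ^ b) (𝓝 0) (𝓝 0) := by
    have := ENNReal.Tendsto.const_mul (a := c)
      ((ENNReal.continuous_rpow_const (y := b)).tendsto 0) (Or.inr ENNReal.coe_ne_top)
    simpa [ENNReal.zero_rpow_of_pos hb] using this
  obtain ⟨ε, hε, hsub⟩ := ENNReal.nhds_zero_basis.mem_iff.1 (h.eventually (gt_mem_nhds hη))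
  exact ⟨ε, hε, fun t ht => hsub ht⟩

/-! ### Function quasi-norms and function norms -/

namespace FunctionQuasiNorm

variable {α : Type*} [MeasurableSpace α] {μ : Measure α}

theorem toFun_zero (ρ : FunctionQuasiNorm μ) : ρ.toFun (fun _ => 0) = 0 :=
  (ρ.eq_zero_iff' _ aemeasurable_const).2 (Eventually.of_forall fun _ => rfl)

/-- The set where `f` is infinite carries arbitrarily large multiples of its characteristic function
below `f`, so the quasi-norm of that characteristic function is `0`. -/
theorem ae_lt_top_of_toFun_lt_top (ρ : FunctionQuasiNorm μ) {f : α → ℝ≥0∞}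
    (hf : AEMeasurable f μ) (h : ρ.toFun f < ∞) : ∀ᵐ x ∂μ, f x < ∞ := by
  set E : Set α := {x | f x = ∞} with hEdef
  have hE : NullMeasurableSet E μ := hf.nullMeasurable (measurableSet_singleton ∞)
  have hχ : AEMeasurable (E.indicator fun _ => (1 : ℝ≥0∞)) μ := aemeasurable_const.indicator₀ hE
  have key : ∀ k : ℕ, (k : ℝ≥0∞) * ρ.toFun (E.indicator fun _ => 1) ≤ ρ.toFun f := fun k => by
    have hs := ρ.smul' (k : ℝ≥0) _ hχ
    rw [ENNReal.coe_natCast] at hs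
    rw [← hs]
    refine ρ.mono' _ _ hf (hχ.const_mul _) (Eventually.of_forall fun x => ?_)
    by_cases hx : x ∈ E
    · have : f x = ∞ := hx
      simp [this]
    · simp [hx]
  have h0 : ρ.toFun (E.indicator fun _ => 1) = 0 := by
    by_contra h0
    obtain ⟨k, hk⟩ := ENNReal.exists_nat_mul_gt h0 h.ne
    exact (hk.trans_le (key k)).false
  filter_upwards [(ρ.eq_zero_iff' _ hχ).1 h0] with x hx
  refine lt_top_iff_ne_top.2 fun hfx => ?_
  have hxE : x ∈ E := hfx
  simp [hxE] at hx

/-- Fatou's lemma for a function quasi-norm. -/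
theorem toFun_le_of_tendsto (ρ : FunctionQuasiNorm μ) {f : ℕ → α → ℝ≥0∞} {g : α → ℝ≥0∞}
    (hf : ∀ k, AEMeasurable (f k) μ) (hg : AEMeasurable g μ)
    (hlim : ∀ᵐ x ∂μ, Tendsto (fun k => f k x) atTop (𝓝 (g x))) {A : ℝ≥0∞}
    (hA : ∀ k, ρ.toFun (f k) ≤ A) : ρ.toFun g ≤ A := by
  have hm : ∀ k, AEMeasurable (fun x => ⨅ j : ℕ, f (j + k) x) μ := fun k =>
    AEMeasurable.iInf fun j => hf (j + k)
  have hmono : ∀ x, Monotone fun k => ⨅ j : ℕ, f (j + k) x := fun x k l hkl =>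
    le_iInf fun j => (iInf_le _ (j + (l - k))).trans_eq (by congr 1; omega)
  refine le_of_tendsto (ρ.tendsto' (fun k x => ⨅ j : ℕ, f (j + k) x) g hm hg
    (Eventually.of_forall hmono) ?_) (Eventually.of_forall fun k =>
      (ρ.mono' (f k) _ (hf k) (hm k) (Eventually.of_forall fun x => ?_)).trans (hA k))
  · filter_upwards [hlim] with x hx
    rw [← hx.liminf_eq, liminf_eq_iSup_iInf_of_nat']
    exact tendsto_atTop_iSup (hmono x)
  · exact (iInf_le _ 0).trans_eq (by simp)

theorem IsFunctionNorm.toFun_add_le {σ : FunctionQuasiNorm μ} (hσ : σ.IsFunctionNorm)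
    {f g : α → ℝ≥0∞} (hf : AEMeasurable f μ) (hg : AEMeasurable g μ) :
    σ.toFun (fun x => f x + g x) ≤ σ.toFun f + σ.toFun g :=
  hσ.1 f g hf hg

theorem IsFunctionNorm.toFun_sum_le {σ : FunctionQuasiNorm μ} (hσ : σ.IsFunctionNorm)
    {f : ℕ → α → ℝ≥0∞} (hf : ∀ k, AEMeasurable (f k) μ) (s : Finset ℕ) :
    σ.toFun (fun x => ∑ k ∈ s, f k x) ≤ ∑ k ∈ s, σ.toFun (f k) := by
  classical
  induction s using Finset.induction_on with
  | empty => simp [σ.toFun_zero]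
  | insert a s ha ih =>
    simp only [Finset.sum_insert ha]
    exact (hσ.toFun_add_le (hf a) (Finset.aemeasurable_fun_sum s fun k _ => hf k)).trans
      (add_le_add le_rfl ih)

/-- The triangle inequality for series follows from the one for finite sums by Fatou's lemma. -/
theorem IsFunctionNorm.toFun_tsum_le {σ : FunctionQuasiNorm μ} (hσ : σ.IsFunctionNorm)
    {f : ℕ → α → ℝ≥0∞} (hf : ∀ k, AEMeasurable (f k) μ) :
    σ.toFun (fun x => ∑' k, f k x) ≤ ∑' k, σ.toFun (f k) :=
  σ.toFun_le_of_tendsto (f := fun m x => ∑ k ∈ Finset.range m, f k x)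
    (fun _ => Finset.aemeasurable_fun_sum _ fun k _ => hf k)
    (AEMeasurable.tsum hf)
    (Eventually.of_forall fun _ => ENNReal.tendsto_nat_tsum _)
    fun _ => (hσ.toFun_sum_le hf _).trans (ENNReal.sum_le_tsum _)

/-- Equivalence of the quasi-norms of two coinciding spaces extends from the elements of the spaces
to all measurable functions with values in `[0, ∞]`. -/
theorem Coincides.toFun_le {ρ σ : FunctionQuasiNorm μ} (h : ρ.Coincides σ) :
    ∃ c₁ c₂ : ℝ≥0, ∀ f : α → ℝ≥0∞, AEMeasurable f μ →
      ρ.toFun f ≤ c₁ * σ.toFun f ∧ σ.toFun f ≤ c₂ * ρ.toFun f := by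
  obtain ⟨hs, c₁, c₂, hc₁, hc₂, hle⟩ := h
  refine ⟨c₁, c₂, fun f hf => ?_⟩
  by_cases hfin : ∀ᵐ x ∂μ, f x < ∞
  · -- a finite `f` is a.e. the modulus of an element `u` of `α →ₘ[μ] ℂ`
    have hm : AEStronglyMeasurable (fun x => ((f x).toReal : ℂ)) μ :=
      (Complex.measurable_ofReal.comp_aemeasurable hf.ennreal_toReal).aestronglyMeasurable
    set u : α →ₘ[μ] ℂ := AEEqFun.mk _ hm with hu
    have hfu : f =ᵐ[μ] fun x => ‖u x‖ₑ := by
      filter_upwards [hfin, AEEqFun.coeFn_mk _ hm] with x hx hux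
      rw [hu, hux, ← ofReal_norm, Complex.norm_real, Real.norm_eq_abs,
        abs_of_nonneg ENNReal.toReal_nonneg, ENNReal.ofReal_toReal hx.ne]
    have e₁ : ρ.toFun f = ρ.qnorm u := ρ.toFun_congr hf hfu
    have e₂ : σ.toFun f = σ.qnorm u := σ.toFun_congr hf hfu
    rw [e₁, e₂]
    by_cases hmem : u ∈ ρ.space
    · exact hle u hmem
    · have hmem' : u ∉ σ.space := hs ▸ hmem
      rw [mem_space, not_lt_top_iff] at hmem hmem'
      rw [hmem, hmem']
      simp [hc₁.ne', hc₂.ne']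
  · have h₁ : ρ.toFun f = ∞ := by
      by_contra h'
      exact hfin (ρ.ae_lt_top_of_toFun_lt_top hf (lt_top_iff_ne_top.2 h'))
    have h₂ : σ.toFun f = ∞ := by
      by_contra h'
      exact hfin (σ.ae_lt_top_of_toFun_lt_top hf (lt_top_iff_ne_top.2 h'))
    rw [h₁, h₂]
    simp [hc₁.ne', hc₂.ne']

theorem hasBasis_uniformity (ρ : FunctionQuasiNorm μ) :
    (uniformity ρ.space).HasBasis (fun ε : ℝ≥0∞ => 0 < ε)
      fun ε => {p | ρ.qnorm ((p.1 - p.2 : ρ.space) : α →ₘ[μ] ℂ) < ε} := by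
  refine ⟨fun t => (FilterBasis.mem_filter_iff ρ.entourageBasis).trans ⟨?_, ?_⟩⟩
  · rintro ⟨_, ⟨ε, hε, rfl⟩, h⟩
    exact ⟨ε, hε, h⟩
  · rintro ⟨ε, hε, h⟩
    exact ⟨_, ⟨ε, hε, rfl⟩, h⟩

theorem qnorm_coe_sub (ρ : FunctionQuasiNorm μ) (u v : ρ.space) :
    ρ.qnorm ((u - v : ρ.space) : α →ₘ[μ] ℂ) =
      ρ.toFun fun x => ‖(u : α →ₘ[μ] ℂ) x - (v : α →ₘ[μ] ℂ) x‖ₑ := by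
  refine ρ.toFun_congr (aemeasurable_enorm_coe _) ?_
  filter_upwards [AEEqFun.coeFn_sub (u : α →ₘ[μ] ℂ) (v : α →ₘ[μ] ℂ)] with x hx
  simp [hx]

/-- For a power quasi-Banach function space, `u ↦ σ(|u|^b)` is a subadditive functional that is
equivalent to the `b`-th power of the quasi-norm. -/
theorem IsPower.exists_rpow_equiv {ρ : FunctionQuasiNorm μ} (hρ : ρ.IsPower) :
    ∃ (b : ℝ) (σ : FunctionQuasiNorm μ) (c₁ c₂ : ℝ≥0), 0 < b ∧ b ≤ 1 ∧ σ.IsFunctionNorm ∧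
      ∀ f : α → ℝ≥0∞, AEMeasurable f μ →
        ρ.toFun f ^ b ≤ c₁ * σ.toFun (fun x => f x ^ b) ∧
          σ.toFun (fun x => f x ^ b) ≤ c₂ * ρ.toFun f ^ b := by
  obtain ⟨b, hb, hb1, σ, hσ, hc⟩ := hρ
  obtain ⟨c₁, c₂, h⟩ := hc.toFun_le
  refine ⟨b, σ, c₁, c₂, hb, hb1, hσ, fun f hf => ?_⟩
  have e : (ρ.power b hb).toFun (fun x => f x ^ b) = ρ.toFun f ^ b := by
    simp only [power, ← ENNReal.rpow_mul, mul_one_div_cancel hb.ne', ENNReal.rpow_one]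
  simpa only [e] using h _ (hf.pow_const b)

/-! ### Minkowski's integral inequality -/

/-- Minkowski's integral inequality for function norms, with the supremum over the parameter on the
right-hand side. By the strong law of large numbers the integral over `ω` is, for almost every
sequence of sample points, the a.e. limit of finite averages of the functions `F (·) ω`; finite
averages are controlled by the triangle inequality, and the limit by Fatou's lemma. -/
theorem IsFunctionNorm.toFun_lintegral_le [SFinite μ] {σ : FunctionQuasiNorm μ}
    (hσ : σ.IsFunctionNorm) {Ω : Type*} [MeasurableSpace Ω] (P : Measure Ω)
    [IsProbabilityMeasure P] {F : α → Ω → ℝ≥0} (hF : Measurable (Function.uncurry F))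
    (hfin : ∀ᵐ x ∂μ, ∫⁻ ω, F x ω ∂P < ∞) {A : ℝ≥0∞}
    (hA : ∀ᵐ ω ∂P, σ.toFun (fun x => F x ω) ≤ A) :
    σ.toFun (fun x => ∫⁻ ω, F x ω ∂P) ≤ A := by
  set Q : Measure (ℕ → Ω) := Measure.infinitePi fun _ => P with hQ
  -- `S n ω x` is the average of `F x` over the first `n` sample points of `ω`.
  set S : ℕ → (ℕ → Ω) → α → ℝ≥0∞ := fun n ω x =>
    ((n : ℝ≥0)⁻¹ : ℝ≥0) * ∑ i ∈ Finset.range n, (F x (ω i) : ℝ≥0∞) with hS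
  have hFm : ∀ i, Measurable fun z : α × (ℕ → Ω) => F z.1 (z.2 i) := fun i =>
    hF.comp (measurable_fst.prodMk ((measurable_pi_apply i).comp measurable_snd))
  have hSm : ∀ n, Measurable fun z : α × (ℕ → Ω) => S n z.2 z.1 := fun n =>
    (Finset.measurable_fun_sum _ fun i _ => (hFm i).coe_nnreal_ennreal).const_mul _
  have hg : Measurable fun x => ∫⁻ ω, F x ω ∂P := hF.coe_nnreal_ennreal.lintegral_prod_right
  have h1 : ∀ᵐ x ∂μ, ∀ᵐ ω ∂Q, Tendsto (fun n => S n ω x) atTop (𝓝 (∫⁻ ω, F x ω ∂P)) := by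
    filter_upwards [hfin] with x hx
    have hFx : Measurable (F x) := hF.of_uncurry_left
    have hmp : ∀ i : ℕ, MeasurePreserving (Function.eval i) Q P := fun i =>
      measurePreserving_eval_infinitePi (fun _ : ℕ => P) i
    have hint : Integrable (fun ω => (F x ω : ℝ)) P := by
      refine ⟨hFx.coe_nnreal_real.aestronglyMeasurable, ?_⟩
      simpa [HasFiniteIntegral, enorm_eq_nnnorm] using hx
    have hX : ProbabilityTheory.iIndepFun (fun i (ω : ℕ → Ω) => (F x (ω i) : ℝ)) Q :=
      ProbabilityTheory.iIndepFun_infinitePi (P := fun _ : ℕ => P)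
        (X := fun _ ω => (F x ω : ℝ)) fun _ => hFx.coe_nnreal_real
    have hident : ∀ i, ProbabilityTheory.IdentDistrib (fun ω : ℕ → Ω => (F x (ω i) : ℝ))
        (fun ω => (F x (ω 0) : ℝ)) Q Q := fun i => by
      refine ⟨(hFx.coe_nnreal_real.comp (measurable_pi_apply i)).aemeasurable,
        (hFx.coe_nnreal_real.comp (measurable_pi_apply 0)).aemeasurable, ?_⟩
      have e : ∀ j : ℕ, Measure.map (fun ω : ℕ → Ω => (F x (ω j) : ℝ)) Q
          = Measure.map (fun ω => (F x ω : ℝ)) P := fun j => by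
        rw [← (hmp j).map_eq, Measure.map_map hFx.coe_nnreal_real (hmp j).measurable]
        rfl
      rw [e, e]
    have hslln := ProbabilityTheory.strong_law_ae_real
      (fun i (ω : ℕ → Ω) => (F x (ω i) : ℝ))
      ((hmp 0).integrable_comp_of_integrable hint)
      (fun i j hij => hX.indepFun hij) hident
    have hmean : ∫ ω, (F x (ω 0) : ℝ) ∂Q = ∫ ω, (F x ω : ℝ) ∂P := by
      conv_rhs => rw [← (hmp 0).map_eq]
      rw [integral_map (hmp 0).measurable.aemeasurable
        hFx.coe_nnreal_real.aestronglyMeasurable]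
    have hlim : ENNReal.ofReal (∫ ω, (F x ω : ℝ) ∂P) = ∫⁻ ω, F x ω ∂P := by
      rw [ofReal_integral_eq_lintegral_ofReal hint
        (Eventually.of_forall fun _ => NNReal.coe_nonneg _)]
      simp
    filter_upwards [hslln] with ω hω
    rw [hmean] at hω
    rw [← hlim]
    refine (ENNReal.tendsto_ofReal hω).congr fun n => ?_
    have : (∑ i ∈ Finset.range n, (F x (ω i) : ℝ)) / n
        = (((n : ℝ≥0)⁻¹ * ∑ i ∈ Finset.range n, F x (ω i) : ℝ≥0) : ℝ) := by
      push_cast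
      rw [div_eq_inv_mul]
    rw [this, ENNReal.ofReal_coe_nnreal]
    simp [hS]
  have h2 : ∀ᵐ ω ∂Q, ∀ᵐ x ∂μ, Tendsto (fun n => S n ω x) atTop (𝓝 (∫⁻ ω, F x ω ∂P)) := by
    refine (Measure.ae_ae_comm ?_).1 h1
    exact measurableSet_tendsto_fun hSm (hg.comp measurable_fst)
  have h3 : ∀ᵐ ω ∂Q, ∀ i, σ.toFun (fun x => F x (ω i)) ≤ A := ae_all_iff.2 fun i =>
    (measurePreserving_eval_infinitePi (fun _ : ℕ => P) i).quasiMeasurePreserving.ae hA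
  obtain ⟨ω, hω, hωA⟩ := (h2.and h3).exists
  have hFω : ∀ i, AEMeasurable (fun x => (F x (ω i) : ℝ≥0∞)) μ := fun i =>
    (hF.comp (measurable_id.prodMk measurable_const)).coe_nnreal_ennreal.aemeasurable
  have hsum : ∀ n, AEMeasurable (fun x => ∑ i ∈ Finset.range n, (F x (ω i) : ℝ≥0∞)) μ := fun n =>
    Finset.aemeasurable_fun_sum _ fun i _ => hFω i
  refine σ.toFun_le_of_tendsto (f := fun n => S n ω) (fun n => (hsum n).const_mul _)
    hg.aemeasurable hω fun n => ?_
  calc σ.toFun (S n ω)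
      = ((n : ℝ≥0)⁻¹ : ℝ≥0) * σ.toFun (fun x => ∑ i ∈ Finset.range n, (F x (ω i) : ℝ≥0∞)) :=
        σ.smul' _ _ (hsum n)
    _ ≤ ((n : ℝ≥0)⁻¹ : ℝ≥0) * ∑ i ∈ Finset.range n, A := by
        gcongr
        exact (hσ.toFun_sum_le hFω _).trans (Finset.sum_le_sum fun i _ => hωA i)
    _ ≤ A := by
        rw [Finset.sum_const, Finset.card_range, nsmul_eq_mul, ← mul_assoc, ← ENNReal.coe_natCast,
          ← ENNReal.coe_mul]
        refine mul_le_of_le_one_left' ?_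
        exact_mod_cast inv_mul_le_one

/-! ### Completeness -/

instance isCountablyGenerated_uniformity (ρ : FunctionQuasiNorm μ) :
    (uniformity ρ.space).IsCountablyGenerated := by
  have hb : (uniformity ρ.space).HasBasis (fun _ : ℕ => True) fun n =>
      {p | ρ.qnorm ((p.1 - p.2 : ρ.space) : α →ₘ[μ] ℂ) < (n : ℝ≥0∞)⁻¹} := by
    refine ρ.hasBasis_uniformity.to_hasBasis (fun ε hε => ?_) fun n _ =>
      ⟨_, ENNReal.inv_pos.2 (ENNReal.natCast_ne_top n), subset_rfl⟩
    obtain ⟨n, hn⟩ := ENNReal.exists_inv_nat_lt hε.ne'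
    exact ⟨n, trivial, fun p hp => lt_trans hp hn⟩
  exact (HasCountableBasis.mk hb (Set.to_countable _)).isCountablyGenerated

theorem aemeasurable_enorm_coe_sub (u v : α →ₘ[μ] ℂ) :
    AEMeasurable (fun x => ‖u x - v x‖ₑ) μ :=
  (u.aestronglyMeasurable.sub v.aestronglyMeasurable).enorm

/-- The Riesz–Fischer theorem for power quasi-Banach function spaces. A sequence that is Cauchy with
geometric rate for `(u, v) ↦ σ(|u - v|^b)` converges a.e., because `∑ |u_k - u_{k+1}|^b` has finite
norm; Fatou's lemma shows that the a.e. limit is the limit in `X(ρ)`. -/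
theorem IsPower.completeSpace {ρ : FunctionQuasiNorm μ} (hρ : ρ.IsPower) :
    CompleteSpace ρ.space := by
  obtain ⟨b, σ, c₁, c₂, hb, hb1, hσ, heq⟩ := hρ.exists_rpow_equiv
  refine UniformSpace.complete_of_convergent_controlled_sequences
    (fun k => {p | σ.toFun (fun x => ‖(p.1 : α →ₘ[μ] ℂ) x - (p.2 : α →ₘ[μ] ℂ) x‖ₑ ^ b)
      < (2 : ℝ≥0∞)⁻¹ ^ k}) (fun k => ?_) fun u hu => ?_
  · obtain ⟨ε, hε, h⟩ := ENNReal.exists_forall_lt_mul_rpow_lt c₂ hb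
      (η := (2 : ℝ≥0∞)⁻¹ ^ k) (ENNReal.pow_pos (by simp) k)
    refine ρ.hasBasis_uniformity.mem_iff.2 ⟨ε, hε, fun p hp => ?_⟩
    have hp' : ρ.qnorm ((p.1 - p.2 : ρ.space) : α →ₘ[μ] ℂ) < ε := hp
    rw [qnorm_coe_sub] at hp'
    exact (heq _ (aemeasurable_enorm_coe_sub _ _)).2.trans_lt (h _ hp')
  · have hu' : ∀ k m n, k ≤ m → k ≤ n → σ.toFun (fun x =>
        ‖(u m : α →ₘ[μ] ℂ) x - (u n : α →ₘ[μ] ℂ) x‖ₑ ^ b) ≤ (2 : ℝ≥0∞)⁻¹ ^ k :=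
      fun k m n hm hn => (hu k m n hm hn).le
    have hd : ∀ m n, AEMeasurable
        (fun x => ‖(u m : α →ₘ[μ] ℂ) x - (u n : α →ₘ[μ] ℂ) x‖ₑ ^ b) μ := fun m n =>
      (aemeasurable_enorm_coe_sub _ _).pow_const b
    have hlt : σ.toFun (fun x => ∑' k, ‖(u k : α →ₘ[μ] ℂ) x - (u (k + 1) : α →ₘ[μ] ℂ) x‖ₑ ^ b)
        < ∞ := by
      refine ((hσ.toFun_tsum_le fun k => hd k (k + 1)).trans
        (ENNReal.tsum_le_tsum fun k => hu' k k (k + 1) le_rfl (Nat.le_succ k))).trans_lt ?_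
      rw [ENNReal.tsum_geometric]
      simp
    have hcauchy : ∀ᵐ x ∂μ, ∃ l, Tendsto (fun k => (u k : α →ₘ[μ] ℂ) x) atTop (𝓝 l) := by
      filter_upwards [σ.ae_lt_top_of_toFun_lt_top (AEMeasurable.tsum fun k => hd k (k + 1)) hlt]
        with x hx
      refine cauchySeq_tendsto_of_complete (cauchySeq_of_edist_le_of_tsum_ne_top _
        (fun k => (edist_eq_enorm_sub _ _).le)
        (ENNReal.tsum_ne_top_of_tsum_rpow_ne_top hb hb1 hx.ne))
    obtain ⟨f, hf, hlim⟩ := exists_stronglyMeasurable_limit_of_tendsto_ae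
      (fun k => (u k : α →ₘ[μ] ℂ).aestronglyMeasurable) hcauchy
    set v : α →ₘ[μ] ℂ := AEEqFun.mk f hf.aestronglyMeasurable with hv
    have hvlim : ∀ᵐ x ∂μ, Tendsto (fun k => (u k : α →ₘ[μ] ℂ) x) atTop (𝓝 (v x)) := by
      filter_upwards [hlim, AEEqFun.coeFn_mk f hf.aestronglyMeasurable] with x hx hvx
      rwa [hv, hvx]
    have hconv : ∀ k m, k ≤ m → σ.toFun (fun x => ‖v x - (u m : α →ₘ[μ] ℂ) x‖ₑ ^ b)
        ≤ (2 : ℝ≥0∞)⁻¹ ^ k := fun k m hm => by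
      refine σ.toFun_le_of_tendsto (fun j => hd (j + k) m)
        ((aemeasurable_enorm_coe_sub _ _).pow_const b) ?_
        fun j => hu' k (j + k) m (Nat.le_add_left k j) hm
      filter_upwards [hvlim] with x hx
      have hx' := (tendsto_add_atTop_iff_nat k).2 hx
      exact (ENNReal.continuous_rpow_const.tendsto _).comp
        ((continuous_enorm.tendsto _).comp (hx'.sub_const _))
    have hqv : ∀ k m, k ≤ m → ρ.toFun (fun x => ‖v x - (u m : α →ₘ[μ] ℂ) x‖ₑ) ^ b
        ≤ c₁ * (2 : ℝ≥0∞)⁻¹ ^ k := fun k m hm =>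
      (heq _ (aemeasurable_enorm_coe_sub _ _)).1.trans (mul_le_mul_right (hconv k m hm) _)
    have hmem : v ∈ ρ.space := by
      have hsub : v - u 0 ∈ ρ.space := by
        have e : ρ.qnorm (v - u 0 : α →ₘ[μ] ℂ)
            = ρ.toFun (fun x => ‖v x - (u 0 : α →ₘ[μ] ℂ) x‖ₑ) := by
          refine ρ.toFun_congr (aemeasurable_enorm_coe _) ?_
          filter_upwards [AEEqFun.coeFn_sub v (u 0 : α →ₘ[μ] ℂ)] with x hx
          simp [hx]
        rw [mem_space, e, ← ENNReal.rpow_lt_top_iff_of_pos hb]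
        exact (hqv 0 0 le_rfl).trans_lt (by simp)
      simpa using ρ.space.add_mem hsub (u 0).2
    refine ⟨⟨v, hmem⟩, ?_⟩
    rw [(nhds_basis_uniformity' ρ.hasBasis_uniformity).tendsto_right_iff]
    intro ε hε
    obtain ⟨δ, hδ, h⟩ := ENNReal.exists_forall_lt_mul_rpow_lt c₁ one_pos
      (η := ε ^ b) (ENNReal.rpow_pos_of_nonneg hε hb.le)
    obtain ⟨k, hk⟩ := ENNReal.exists_inv_two_pow_lt hδ.ne'
    filter_upwards [eventually_ge_atTop k] with m hm
    change ρ.qnorm (((⟨v, hmem⟩ : ρ.space) - u m : ρ.space) : α →ₘ[μ] ℂ) < ε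
    rw [qnorm_coe_sub, ← ENNReal.rpow_lt_rpow_iff hb]
    exact (hqv k m hm).trans_lt (by simpa using h _ hk)

end FunctionQuasiNorm

/-! ### Necessity: totally bounded sets -/

theorem exists_finite_net_of_totallyBounded {X : Type*} [UniformSpace X]
    {K S : Set X} (hK : TotallyBounded K) (hS : K ⊆ closure S) {V : Set (X × X)}
    (hV : V ∈ uniformity X) :
    ∃ t : Set X, t ⊆ S ∧ t.Finite ∧ ∀ u ∈ K, ∃ y ∈ t, (u, y) ∈ V := by
  obtain ⟨W, hW, hWV⟩ := comp_mem_uniformity_sets hV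
  obtain ⟨t, htK, ht, hcov⟩ := totallyBounded_iff_subset.1 hK W hW
  have hclose : ∀ y : t, ∃ s ∈ S, ((y : X), s) ∈ W := fun y => by
    obtain ⟨s, hs, hsS⟩ := UniformSpace.mem_closure_iff_ball.1 (hS (htK y.2)) hW
    exact ⟨s, hsS, hs⟩
  choose g hgS hgW using hclose
  have := ht.to_subtype
  refine ⟨Set.range g, Set.range_subset_iff.2 hgS, Set.finite_range g, fun u hu => ?_⟩
  obtain ⟨y, hy, huy⟩ := Set.mem_iUnion₂.1 (hcov hu)
  exact ⟨g ⟨y, hy⟩, ⟨_, rfl⟩, hWV ⟨y, huy, hgW ⟨y, hy⟩⟩⟩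

namespace FunctionQuasiNorm

section

variable {α : Type*} [MeasurableSpace α] {μ : Measure α}

/-- A totally bounded set in the closure of `S` has finite `ε`-nets consisting of elements
of `S`. -/
theorem exists_finite_net (ρ : FunctionQuasiNorm μ) {K S : Set ρ.space} (hK : TotallyBounded K)
    (hS : K ⊆ closure S) {ε : ℝ≥0∞} (hε : 0 < ε) :
    ∃ t ⊆ S, t.Finite ∧ ∀ u ∈ K, ∃ y ∈ t,
      ρ.toFun (fun x => ‖(u : α →ₘ[μ] ℂ) x - (y : α →ₘ[μ] ℂ) x‖ₑ) < ε := by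
  obtain ⟨t, htS, ht, h⟩ := exists_finite_net_of_totallyBounded hK hS
    (ρ.hasBasis_uniformity.mem_of_mem hε)
  refine ⟨t, htS, ht, fun u hu => ?_⟩
  obtain ⟨y, hy, huy⟩ := h u hu
  exact ⟨y, hy, by rw [← qnorm_coe_sub]; exact huy⟩

theorem isBoundedIn_of_totallyBounded (ρ : FunctionQuasiNorm μ) {K : Set ρ.space}
    (hK : TotallyBounded K) : ρ.IsBoundedIn K := by
  obtain ⟨C, -, hC⟩ := ρ.exists_add_le'
  obtain ⟨t, -, ht, hnet⟩ := ρ.exists_finite_net hK subset_closure one_pos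
  have hM : ∑ y ∈ ht.toFinset, ρ.qnorm (y : α →ₘ[μ] ℂ) < ∞ := ENNReal.sum_lt_top.2 fun y _ => y.2
  have hfin : C * (1 + ∑ y ∈ ht.toFinset, ρ.qnorm (y : α →ₘ[μ] ℂ)) ≠ ∞ :=
    ENNReal.mul_ne_top ENNReal.coe_ne_top (ENNReal.add_ne_top.2 ⟨ENNReal.one_ne_top, hM.ne⟩)
  refine ⟨(C * (1 + ∑ y ∈ ht.toFinset, ρ.qnorm (y : α →ₘ[μ] ℂ))).toNNReal, fun u hu => ?_⟩
  rw [ENNReal.coe_toNNReal hfin]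
  obtain ⟨y, hy, huy⟩ := hnet u hu
  have hm := aemeasurable_enorm_coe_sub (u : α →ₘ[μ] ℂ) (y : α →ₘ[μ] ℂ)
  calc ρ.qnorm (u : α →ₘ[μ] ℂ)
      ≤ ρ.toFun (fun x => ‖(u : α →ₘ[μ] ℂ) x - (y : α →ₘ[μ] ℂ) x‖ₑ + ‖(y : α →ₘ[μ] ℂ) x‖ₑ) :=
        ρ.mono' _ _ (hm.add (aemeasurable_enorm_coe _)) (aemeasurable_enorm_coe _)
          (Eventually.of_forall fun x => by
            simpa using enorm_add_le ((u : α →ₘ[μ] ℂ) x - (y : α →ₘ[μ] ℂ) x) ((y : α →ₘ[μ] ℂ) x))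
    _ ≤ C * (ρ.toFun (fun x => ‖(u : α →ₘ[μ] ℂ) x - (y : α →ₘ[μ] ℂ) x‖ₑ)
          + ρ.qnorm (y : α →ₘ[μ] ℂ)) := hC _ _ hm (aemeasurable_enorm_coe _)
    _ ≤ C * (1 + ∑ y ∈ ht.toFinset, ρ.qnorm (y : α →ₘ[μ] ℂ)) := by
        gcongr
        exact Finset.single_le_sum (f := fun y : ρ.space => ρ.qnorm (y : α →ₘ[μ] ℂ))
          (fun _ _ => zero_le) (ht.mem_toFinset.2 hy)

/-- Outside the union of the supports of the functions of a finite net, an element of `K` differs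
from the nearest function of the net by exactly itself. -/
theorem hasUniformlySmallTails_of_totallyBounded [TopologicalSpace α] [OpensMeasurableSpace α]
    [R1Space α] (ρ : FunctionQuasiNorm μ) {K : Set ρ.space} (hK : TotallyBounded K)
    (hS : K ⊆ closure ρ.compactlySupported) : ρ.HasUniformlySmallTails K := by
  intro ε hε
  obtain ⟨t, htS, ht, hnet⟩ := ρ.exists_finite_net hK hS (ENNReal.coe_pos.2 hε)
  choose! φ hφ hφs hφe using fun y (hy : y ∈ t) => htS hy
  refine ⟨⋃ y ∈ t, tsupport (φ y), ht.isCompact_biUnion fun y hy => hφs y hy, fun u hu => ?_⟩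
  obtain ⟨y, hy, huy⟩ := hnet u hu
  have hG : MeasurableSet (⋃ y ∈ t, tsupport (φ y)) :=
    ht.measurableSet_biUnion fun y _ => (isClosed_tsupport _).measurableSet
  refine lt_of_le_of_lt (ρ.mono' _ _ (aemeasurable_enorm_coe_sub _ _)
    (((u : α →ₘ[μ] ℂ).aestronglyMeasurable.indicator hG.compl).enorm) ?_) huy
  filter_upwards [hφe y hy] with x hx
  by_cases hxG : x ∈ ⋃ y ∈ t, tsupport (φ y)
  · rw [Set.indicator_of_notMem (Set.notMem_compl_iff.2 hxG)]
    simp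
  · have h0 : φ y x = 0 := by
      by_contra h0
      exact hxG (Set.mem_biUnion hy (subset_tsupport _ h0))
    rw [Set.indicator_of_mem hxG, hx, h0, sub_zero]

end

variable {E : Type*} [NormedAddCommGroup E] [MeasurableSpace E] [BorelSpace E]

theorem aemeasurable_translate {μ : Measure E} [μ.IsAddRightInvariant]
    {f : E → ℝ≥0∞} (hf : AEMeasurable f μ) (h : E) : AEMeasurable (fun x => f (x + h)) μ :=
  hf.comp_quasiMeasurePreserving (measurePreserving_add_right μ h).quasiMeasurePreserving

theorem IsRearrangementInvariant.toFun_translate {μ : Measure E} [μ.IsAddRightInvariant]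
    {σ : FunctionQuasiNorm μ} (hσ : σ.IsRearrangementInvariant) {f : E → ℝ≥0∞}
    (hf : AEMeasurable f μ) (hfin : ∀ᵐ x ∂μ, f x < ∞) (h : E) :
    σ.toFun (fun x => f (x + h)) = σ.toFun f := by
  refine hσ _ _ (aemeasurable_translate hf h) hf
    ((measurePreserving_add_right μ h).quasiMeasurePreserving.ae hfin) hfin fun t => ?_
  exact measure_preimage_add_right μ h {x | (t : ℝ≥0∞) < f x}

/-- Translation is continuous at a continuous function `φ` with compact support: if `‖h‖ ≤ 1`, then
`φ(· + h) - φ` vanishes off the closed `1`-neighbourhood of the support of `φ`, a set of finite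
measure, and it is uniformly small for small `h`. -/
theorem eventually_toFun_translate_sub_lt [ProperSpace E] {μ : Measure E}
    [IsFiniteMeasureOnCompacts μ] (ρ : FunctionQuasiNorm μ) {φ : E → ℂ}
    (hφ : Continuous φ) (hs : HasCompactSupport φ) {ε : ℝ≥0∞} (hε : 0 < ε) :
    ∀ᶠ h in 𝓝 (0 : E), ρ.toFun (fun x => ‖φ (x + h) - φ x‖ₑ) < ε := by
  set B := Metric.cthickening 1 (tsupport φ) with hB
  have hBc : IsCompact B := hs.isCompact.cthickening
  have hBm : MeasurableSet B := Metric.isClosed_cthickening.measurableSet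
  have hBfin : ρ.toFun (B.indicator fun _ => 1) < ∞ :=
    ρ.indicator_lt_top' B hBm.nullMeasurableSet hBc.measure_lt_top
  have hχ : AEMeasurable (B.indicator fun _ => (1 : ℝ≥0∞)) μ := aemeasurable_const.indicator hBm
  obtain ⟨η, hη, hlt⟩ := ENNReal.exists_forall_lt_mul_rpow_lt
    (ρ.toFun (B.indicator fun _ => 1)).toNNReal one_pos hε
  simp only [ENNReal.coe_toNNReal hBfin.ne, ENNReal.rpow_one] at hlt
  obtain ⟨r, hr, hrη⟩ := ENNReal.lt_iff_exists_nnreal_btwn.1 hη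
  have hr0 : (0 : ℝ) < r := by exact_mod_cast hr
  obtain ⟨δ, hδ, hunif⟩ := Metric.uniformContinuous_iff.1
    (hs.uniformContinuous_of_continuous hφ) r hr0
  filter_upwards [Metric.ball_mem_nhds (0 : E) (lt_min hδ one_pos)] with h hh
  rw [mem_ball_zero_iff, lt_min_iff] at hh
  refine lt_of_le_of_lt (ρ.mono' (fun x => (r : ℝ≥0∞) * B.indicator (fun _ => 1) x) _
    (hχ.const_mul _) ?_ (Eventually.of_forall fun x => ?_)) ?_
  · exact ((hφ.comp (continuous_add_const h)).sub hφ).enorm.aemeasurable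
  · by_cases hx : x ∈ B
    · have hd : ‖φ (x + h) - φ x‖ < r := by
        rw [← dist_eq_norm]
        exact hunif (by simpa [dist_eq_norm] using hh.1)
      have : ‖φ (x + h) - φ x‖ₑ ≤ r := by
        rw [enorm_eq_nnnorm, ENNReal.coe_le_coe, ← NNReal.coe_le_coe]
        exact hd.le
      simpa [hx] using this
    · have h1 : φ x = 0 := by
        by_contra h0
        exact hx (Metric.self_subset_cthickening _ (subset_tsupport _ h0))
      have h2 : φ (x + h) = 0 := by
        by_contra h0
        exact hx (Metric.mem_cthickening_of_dist_le x (x + h) 1 _ (subset_tsupport _ h0)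
          (by simpa [dist_eq_norm] using hh.2.le))
      simp [h1, h2]
  · rw [ρ.smul' _ _ hχ, mul_comm]
    exact hlt r hrη

theorem isUniformlyMeanContinuous_of_totallyBounded {n : ℕ}
    {ρ σ : FunctionQuasiNorm (volume : Measure (EuclideanSpace ℝ (Fin n)))}
    (hσ : σ.IsRearrangementInvariant) (hρσ : ρ.Coincides σ) {K : Set ρ.space}
    (hK : TotallyBounded K) (hS : K ⊆ closure ρ.compactlySupported) :
    ρ.IsUniformlyMeanContinuous K := by
  intro ε hε
  obtain ⟨C, -, hC⟩ := ρ.exists_add_le'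
  obtain ⟨c₁, c₂, hc⟩ := hρσ.toFun_le
  obtain ⟨η, hη, hlt⟩ := ENNReal.exists_forall_lt_mul_rpow_lt
    (C * (C * (c₁ * c₂ + 1) + 1)) one_pos (ENNReal.coe_pos.2 hε)
  simp only [ENNReal.rpow_one] at hlt
  obtain ⟨t, htS, ht, hnet⟩ := ρ.exists_finite_net hK hS hη
  choose! φ hφ hφs hφe using fun y (hy : y ∈ t) => htS hy
  obtain ⟨δ, hδ, hδt⟩ := Metric.eventually_nhds_iff.1 ((eventually_all_finite ht).2 fun y hy =>
    ρ.eventually_toFun_translate_sub_lt (hφ y hy) (hφs y hy) hη)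
  refine ⟨δ, hδ, fun u hu h hh => ?_⟩
  obtain ⟨y, hy, huy⟩ := hnet u hu
  have hyh := hδt (by simpa using hh) y hy
  set f : EuclideanSpace ℝ (Fin n) → ℝ≥0∞ := fun x =>
    ‖(u : EuclideanSpace ℝ (Fin n) →ₘ[volume] ℂ) x
      - (y : EuclideanSpace ℝ (Fin n) →ₘ[volume] ℂ) x‖ₑ with hf
  set g : EuclideanSpace ℝ (Fin n) → ℝ≥0∞ := fun x => ‖φ y (x + h) - φ y x‖ₑ with hg
  have hfm : AEMeasurable f volume := aemeasurable_enorm_coe_sub _ _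
  have hfhm := aemeasurable_translate hfm h
  have hgm : AEMeasurable g volume :=
    (((hφ y hy).comp (continuous_add_const h)).sub (hφ y hy)).enorm.aemeasurable
  have hffin : ∀ᵐ x, f x < ∞ := Eventually.of_forall fun x => enorm_lt_top
  have htr : ρ.toFun (fun x => f (x + h)) ≤ c₁ * c₂ * ρ.toFun f :=
    calc ρ.toFun (fun x => f (x + h)) ≤ c₁ * σ.toFun (fun x => f (x + h)) := (hc _ hfhm).1
      _ = c₁ * σ.toFun f := by rw [hσ.toFun_translate hfm hffin]
      _ ≤ c₁ * (c₂ * ρ.toFun f) := mul_le_mul_right (hc _ hfm).2 _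
      _ = c₁ * c₂ * ρ.toFun f := (mul_assoc _ _ _).symm
  have hmeas : AEMeasurable (fun x => ‖(u : EuclideanSpace ℝ (Fin n) →ₘ[volume] ℂ) (x + h)
      - (u : EuclideanSpace ℝ (Fin n) →ₘ[volume] ℂ) x‖ₑ) volume :=
    (((u : EuclideanSpace ℝ (Fin n) →ₘ[volume] ℂ).stronglyMeasurable.comp_measurable
      (measurable_add_const h)).sub (AEEqFun.stronglyMeasurable _)).enorm.aemeasurable
  calc ρ.qnorm (fun x => (u : EuclideanSpace ℝ (Fin n) →ₘ[volume] ℂ) (x + h)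
        - (u : EuclideanSpace ℝ (Fin n) →ₘ[volume] ℂ) x)
      ≤ ρ.toFun (fun x => (f (x + h) + f x) + g x) := by
        refine ρ.mono' _ _ ((hfhm.add hfm).add hgm) hmeas ?_
        filter_upwards [hφe y hy, (measurePreserving_add_right volume h).quasiMeasurePreserving.ae
          (hφe y hy)] with x hx hxh
        simp only [hf, hg, ← hx, ← hxh]
        simp only [← edist_eq_enorm_sub]
        refine (edist_triangle4 _ ((y : EuclideanSpace ℝ (Fin n) →ₘ[volume] ℂ) (x + h))
          ((y : EuclideanSpace ℝ (Fin n) →ₘ[volume] ℂ) x) _).trans_eq ?_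
        rw [edist_comm ((y : EuclideanSpace ℝ (Fin n) →ₘ[volume] ℂ) x)]
        ring
    _ ≤ C * (C * (ρ.toFun (fun x => f (x + h)) + ρ.toFun f) + ρ.toFun g) :=
        (hC _ _ (hfhm.add hfm) hgm).trans (by gcongr; exact hC _ _ hfhm hfm)
    _ ≤ C * (C * (c₁ * c₂ * max (ρ.toFun f) (ρ.toFun g) + max (ρ.toFun f) (ρ.toFun g))
          + max (ρ.toFun f) (ρ.toFun g)) := by
        gcongr
        · exact htr.trans (by gcongr; exact le_max_left _ _)
        · exact le_max_left _ _
        · exact le_max_right _ _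
    _ = ((C * (C * (c₁ * c₂ + 1) + 1) : ℝ≥0) : ℝ≥0∞) * max (ρ.toFun f) (ρ.toFun g) := by
        push_cast
        ring
    _ < ε := hlt _ (max_lt huy hyh)

end FunctionQuasiNorm

/-! ### Near-minimizers of mean deviations, and means over balls -/

theorem enorm_sub_rpow_le {b : ℝ} (hb : 0 < b) (hb1 : b ≤ 1) (x y z : ℂ) :
    ‖x - z‖ₑ ^ b ≤ ‖x - y‖ₑ ^ b + ‖y - z‖ₑ ^ b := by
  refine le_trans ?_ (ENNReal.rpow_add_le_add_rpow _ _ hb.le hb1)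
  simp only [← edist_eq_enorm_sub]
  exact ENNReal.rpow_le_rpow (edist_triangle x y z) hb.le

/-- A constant `c` that nearly minimizes the `b`-mean deviation from `f` is at least as good an
approximation of an arbitrary number `z` as the values of `f` are on average. -/
theorem exists_forall_enorm_sub_rpow_le_lintegral {Ω : Type*} [MeasurableSpace Ω] (P : Measure Ω)
    [IsProbabilityMeasure P] {f : Ω → ℂ} (hf : Measurable f) {b : ℝ} (hb : 0 < b) (hb1 : b ≤ 1)
    (hfin : ∫⁻ ω, ‖f ω‖ₑ ^ b ∂P < ∞) {η : ℝ≥0∞} (hη : 0 < η) :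
    ∃ c : ℂ, ∀ z : ℂ, ‖z - c‖ₑ ^ b ≤ 2 * ∫⁻ ω, ‖f ω - z‖ₑ ^ b ∂P + η := by
  set I : ℂ → ℝ≥0∞ := fun c => ∫⁻ ω, ‖f ω - c‖ₑ ^ b ∂P with hI
  have hm : ∀ c, Measurable fun ω => ‖f ω - c‖ₑ ^ b := fun c =>
    (hf.sub_const c).enorm.pow_const b
  have hinf : ⨅ c, I c ≠ ∞ := ne_top_of_le_ne_top hfin.ne ((iInf_le I 0).trans_eq (by simp [hI]))
  obtain ⟨c, hc⟩ := iInf_lt_iff.1 (ENNReal.lt_add_right hinf hη.ne')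
  refine ⟨c, fun z => ?_⟩
  calc ‖z - c‖ₑ ^ b = ∫⁻ _, ‖z - c‖ₑ ^ b ∂P := by simp
    _ ≤ ∫⁻ ω, (‖f ω - z‖ₑ ^ b + ‖f ω - c‖ₑ ^ b) ∂P := lintegral_mono fun ω => by
        refine (enorm_sub_rpow_le hb hb1 z (f ω) c).trans_eq ?_
        rw [← edist_eq_enorm_sub, edist_comm, edist_eq_enorm_sub]
    _ = I z + I c := lintegral_add_left (hm z) _
    _ ≤ I z + (I z + η) := by
        gcongr
        exact hc.le.trans (add_le_add (iInf_le I z) le_rfl)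
    _ = 2 * I z + η := by ring

theorem exists_finite_net_enorm_rpow {b : ℝ} (hb : 0 < b) {R η : ℝ≥0∞} (hR : R ≠ ∞)
    (hη : 0 < η) : ∃ T : Set ℂ, T.Finite ∧
      ∀ c : ℂ, ‖c‖ₑ ^ b ≤ R → ∃ d ∈ T, ‖c - d‖ₑ ^ b < η := by
  obtain ⟨T, hT, hcov⟩ := uniformity_basis_edist.totallyBounded_iff.1
    (isCompact_closedBall (0 : ℂ) (R ^ b⁻¹).toReal).totallyBounded (η ^ b⁻¹)
    (ENNReal.rpow_pos_of_nonneg hη (inv_nonneg.2 hb.le))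
  refine ⟨T, hT, fun c hc => ?_⟩
  have hc' : c ∈ Metric.closedBall (0 : ℂ) (R ^ b⁻¹).toReal := by
    rw [mem_closedBall_zero_iff, ← toReal_enorm]
    exact ENNReal.toReal_mono (ENNReal.rpow_ne_top_of_nonneg (inv_nonneg.2 hb.le) hR)
      ((ENNReal.le_rpow_inv_iff hb).2 hc)
  obtain ⟨d, hd, hcd⟩ := Set.mem_iUnion₂.1 (hcov hc')
  refine ⟨d, hd, ?_⟩
  rw [← edist_eq_enorm_sub]
  exact (ENNReal.lt_rpow_inv_iff hb).1 hcd

theorem IsCompact.exists_simpleFunc_dist_lt {X : Type*} [PseudoMetricSpace X]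
    [TopologicalSpace.SeparableSpace X] [Nonempty X] [MeasurableSpace X] [OpensMeasurableSpace X]
    {G : Set X} (hG : IsCompact G) {δ : ℝ} (hδ : 0 < δ) :
    ∃ κ : SimpleFunc X X, ∀ x ∈ G, dist x (κ x) < δ := by
  obtain ⟨t, ht⟩ := hG.elim_finite_subcover
    (fun k => Metric.ball (TopologicalSpace.denseSeq X k) δ) (fun _ => Metric.isOpen_ball)
    fun x _ => by
      obtain ⟨k, hk⟩ := (TopologicalSpace.denseRange_denseSeq X).exists_dist_lt x hδ
      exact Set.mem_iUnion.2 ⟨k, hk⟩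
  refine ⟨SimpleFunc.nearestPt (TopologicalSpace.denseSeq X) (t.sup id), fun x hx => ?_⟩
  obtain ⟨k, hk, hxk⟩ := Set.mem_iUnion₂.1 (ht hx)
  have h := SimpleFunc.edist_nearestPt_le (TopologicalSpace.denseSeq X) x
    (Finset.le_sup (f := id) hk)
  rw [edist_dist, edist_dist, ENNReal.ofReal_le_ofReal_iff dist_nonneg] at h
  rw [dist_comm]
  exact h.trans_lt (by rwa [dist_comm])

theorem lintegral_cond {E : Type*} [MeasurableSpace E] (μ : Measure E) (s : Set E)
    (f : E → ℝ≥0∞) :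
    ∫⁻ y, f y ∂(ProbabilityTheory.cond μ s) = (μ s)⁻¹ * ∫⁻ y in s, f y ∂μ := by
  rw [ProbabilityTheory.cond, lintegral_smul_measure, smul_eq_mul]

theorem setLIntegral_ball_translate {E : Type*} [NormedAddCommGroup E] [MeasurableSpace E]
    [BorelSpace E] (μ : Measure E) [μ.IsAddLeftInvariant] {f : E → ℝ≥0∞} (hf : Measurable f)
    (x : E) (r : ℝ) :
    ∫⁻ h in Metric.ball 0 r, f (x + h) ∂μ = ∫⁻ y in Metric.ball x r, f y ∂μ := by
  have := (measurePreserving_add_left μ x).setLIntegral_comp_preimage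
    (Metric.isOpen_ball (x := x) (ε := r)).measurableSet hf
  rw [← this]
  congr 2
  ext y
  simp

section

open ProbabilityTheory

variable {E : Type*} [NormedAddCommGroup E] [NormedSpace ℝ E] [FiniteDimensional ℝ E]
  [MeasurableSpace E]

theorem isProbabilityMeasure_cond_ball (μ : Measure E) [μ.IsOpenPosMeasure]
    [IsFiniteMeasureOnCompacts μ] (z : E) {δ : ℝ} (hδ : 0 < δ) :
    IsProbabilityMeasure (μ[|Metric.ball z δ]) :=
  cond_isProbabilityMeasure_of_finite (Metric.measure_ball_pos μ z hδ).ne'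
    measure_ball_lt_top.ne

variable [BorelSpace E] (μ : Measure E) [μ.IsAddHaarMeasure]

/-- The mean over a ball of radius `δ` containing `x` is at most `2 ^ dim E` times the mean over the
ball of radius `2 * δ` centred at `x`, which contains it. -/
theorem lintegral_cond_ball_le {f : E → ℝ≥0∞} (hf : Measurable f) {x z : E} {δ : ℝ}
    (hx : dist x z < δ) :
    ∫⁻ y, f y ∂μ[|Metric.ball z δ]
      ≤ 2 ^ Module.finrank ℝ E * ∫⁻ h, f (x + h) ∂μ[|Metric.ball 0 (2 * δ)] := by
  have hsub : Metric.ball z δ ⊆ Metric.ball x (2 * δ) :=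
    Metric.ball_subset_ball' (by rw [dist_comm]; linarith)
  have hvol : μ (Metric.ball (0 : E) (2 * δ))
      = 2 ^ Module.finrank ℝ E * μ (Metric.ball (0 : E) δ) := by
    rw [Measure.addHaar_ball_mul_of_pos μ 0 two_pos δ, ENNReal.ofReal_pow two_pos.le,
      ENNReal.ofReal_ofNat]
  have hpow0 : (2 : ℝ≥0∞) ^ Module.finrank ℝ E ≠ 0 := by simp
  have hpow : (2 : ℝ≥0∞) ^ Module.finrank ℝ E ≠ ∞ := by finiteness
  rw [lintegral_cond, lintegral_cond, setLIntegral_ball_translate μ hf, Measure.addHaar_ball_center,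
    hvol, ENNReal.mul_inv (Or.inl hpow0) (Or.inl hpow), ← mul_assoc, ← mul_assoc,
    ENNReal.mul_inv_cancel hpow0 hpow, one_mul]
  gcongr

end

/-! ### Sufficiency: approximation by step functions -/

namespace FunctionQuasiNorm

open ProbabilityTheory

variable {E : Type*} [NormedAddCommGroup E] [NormedSpace ℝ E] [FiniteDimensional ℝ E]
  [MeasurableSpace E] [BorelSpace E] {μ : Measure E} [μ.IsAddHaarMeasure]

/-- The function that equals `d (κ x)` at the points `x` of `G`, and `0` elsewhere, as an element of
`X(ρ)`. -/
noncomputable def stepFunction (ρ : FunctionQuasiNorm μ) {G : Set E} (hG : IsCompact G)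
    (κ : SimpleFunc E E) (d : κ.range → ℂ) : ρ.space := by
  have hm : Measurable (G.indicator fun x => d ⟨κ x, κ.mem_range_self x⟩) :=
    ((measurable_of_finite d).comp (κ.measurable.subtype_mk)).indicator hG.measurableSet
  refine ⟨AEEqFun.mk _ hm.aestronglyMeasurable, ?_⟩
  have hχ : AEMeasurable (G.indicator fun _ => (1 : ℝ≥0∞)) μ :=
    aemeasurable_const.indicator hG.measurableSet
  rw [mem_space]
  refine lt_of_le_of_lt (ρ.mono'
    (fun x => ((∑ i, ‖d i‖₊ : ℝ≥0) : ℝ≥0∞) * G.indicator (fun _ => 1) x) _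
    (hχ.const_mul _) (aemeasurable_enorm_coe _) ?_) ?_
  · filter_upwards [AEEqFun.coeFn_mk _ hm.aestronglyMeasurable] with x hx
    rw [hx]
    by_cases hxG : x ∈ G
    · simp only [Set.indicator_of_mem hxG, mul_one, enorm_eq_nnnorm, ENNReal.coe_le_coe]
      exact Finset.single_le_sum (f := fun i => ‖d i‖₊) (fun _ _ => zero_le) (Finset.mem_univ _)
    · simp [hxG]
  · rw [ρ.smul' _ _ hχ]
    exact ENNReal.mul_lt_top ENNReal.coe_lt_top
      (ρ.indicator_lt_top' G hG.measurableSet.nullMeasurableSet hG.measure_lt_top)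

theorem coeFn_stepFunction (ρ : FunctionQuasiNorm μ) {G : Set E} (hG : IsCompact G)
    (κ : SimpleFunc E E) (d : κ.range → ℂ) :
    (ρ.stepFunction hG κ d : E →ₘ[μ] ℂ)
      =ᵐ[μ] G.indicator fun x => d ⟨κ x, κ.mem_range_self x⟩ :=
  AEEqFun.coeFn_mk _ _

/-- The mean of `|u(x + h) - u(x)|^b` over `‖h‖ < r` has norm at most `c` if all the functions
`|u(· + h) - u|^b` do. -/
theorem IsFunctionNorm.toFun_mean_oscillation_le {σ : FunctionQuasiNorm μ}
    (hσ : σ.IsFunctionNorm) {u : E → ℂ} (hu : Measurable u) {b : ℝ} (hb : 0 < b) (hb1 : b ≤ 1)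
    {r : ℝ} (hr : 0 < r) (hloc : ∀ x, ∫⁻ y in Metric.ball x r, ‖u y‖ₑ ^ b ∂μ < ∞) {c : ℝ≥0∞}
    (hc : ∀ h : E, ‖h‖ < r → σ.toFun (fun x => ‖u (x + h) - u x‖ₑ ^ b) ≤ c) :
    σ.toFun (fun x => ∫⁻ h, ‖u (x + h) - u x‖ₑ ^ b ∂μ[|Metric.ball 0 r]) ≤ c := by
  have := isProbabilityMeasure_cond_ball μ (0 : E) hr
  have hcoe : ∀ z : ℂ, ((‖z‖₊ ^ b : ℝ≥0) : ℝ≥0∞) = ‖z‖ₑ ^ b := fun z => by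
    rw [ENNReal.coe_rpow_of_nonneg _ hb.le, enorm_eq_nnnorm]
  have key := hσ.toFun_lintegral_le (μ[|Metric.ball (0 : E) r])
    (F := fun x h => ‖u (x + h) - u x‖₊ ^ b) (A := c) ?_ ?_ ?_
  · simpa only [hcoe] using key
  · exact ((hu.comp (measurable_fst.add measurable_snd)).sub
      (hu.comp measurable_fst)).nnnorm.pow_const b
  · refine Eventually.of_forall fun x => ?_
    simp only [hcoe]
    have hm : Measurable fun y => ‖u y‖ₑ ^ b := hu.enorm.pow_const b
    calc ∫⁻ h, ‖u (x + h) - u x‖ₑ ^ b ∂μ[|Metric.ball 0 r]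
        ≤ ∫⁻ h, (‖u (x + h)‖ₑ ^ b + ‖u x‖ₑ ^ b) ∂μ[|Metric.ball 0 r] :=
          lintegral_mono fun h => by
            simpa using enorm_sub_rpow_le hb hb1 (u (x + h)) 0 (u x)
      _ = ∫⁻ h, ‖u (x + h)‖ₑ ^ b ∂μ[|Metric.ball 0 r] + ‖u x‖ₑ ^ b := by
          rw [lintegral_add_right _ measurable_const]
          simp
      _ < ∞ := by
          rw [lintegral_cond, setLIntegral_ball_translate μ hm]
          exact ENNReal.add_lt_top.2 ⟨ENNReal.mul_lt_top
            (ENNReal.inv_lt_top.2 (Metric.measure_ball_pos μ _ hr)) (hloc x),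
            ENNReal.rpow_lt_top_of_nonneg hb.le enorm_lt_top.ne⟩
  · have hae : ∀ᵐ h ∂μ[|Metric.ball (0 : E) r], h ∈ Metric.ball (0 : E) r :=
      Measure.ae_smul_measure (ae_restrict_mem Metric.isOpen_ball.measurableSet) _
    filter_upwards [hae] with h hh
    simp only [hcoe]
    exact hc h (by simpa using hh)

/-- A locally `b`-integrable function is approximated on `G` by a step function with values in a
finite net `T`, with an error controlled by its mean oscillation. The value of the step function on
the part of `G` assigned to `z` is an element of `T` close to a constant which nearly minimizes the
`b`-mean deviation from `u` on the ball about `z`. -/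
theorem exists_step_approximation {u : E → ℂ} (hu : Measurable u) {b : ℝ} (hb : 0 < b)
    (hb1 : b ≤ 1) {δ : ℝ} (hδ : 0 < δ) {G : Set E} {κ : SimpleFunc E E}
    (hκ : ∀ x ∈ G, dist x (κ x) < δ) {R η : ℝ≥0∞} (hR : R ≠ ∞) (hη : 0 < η)
    (hint : ∀ z ∈ κ.range, ∫⁻ y, ‖u y‖ₑ ^ b ∂μ[|Metric.ball z δ] ≤ R) {T : Set ℂ}
    (hT : ∀ c : ℂ, ‖c‖ₑ ^ b ≤ 2 * R + η → ∃ d ∈ T, ‖c - d‖ₑ ^ b < η) :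
    ∃ d : κ.range → ℂ, (∀ i, d i ∈ T) ∧ ∀ x ∈ G,
      ‖u x - d ⟨κ x, κ.mem_range_self x⟩‖ₑ ^ b ≤ 2 * η + 2 * 2 ^ Module.finrank ℝ E *
        ∫⁻ h, ‖u (x + h) - u x‖ₑ ^ b ∂μ[|Metric.ball 0 (2 * δ)] := by
  have hc : ∀ i : κ.range, ∃ c : ℂ, ∀ z : ℂ,
      ‖z - c‖ₑ ^ b ≤ 2 * ∫⁻ y, ‖u y - z‖ₑ ^ b ∂μ[|Metric.ball (i : E) δ] + η := fun i => by
    have := isProbabilityMeasure_cond_ball μ (i : E) hδ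
    exact exists_forall_enorm_sub_rpow_le_lintegral _ hu hb hb1
      ((hint i i.2).trans_lt hR.lt_top) hη
  choose c hc using hc
  have hd : ∀ i, ∃ d ∈ T, ‖c i - d‖ₑ ^ b < η := fun i => hT _ <| by
    have h0 := hc i 0
    simp only [zero_sub, enorm_neg, sub_zero] at h0
    exact h0.trans (by gcongr; exact hint i i.2)
  choose d hdT hd using hd
  refine ⟨d, hdT, fun x hx => ?_⟩
  set i : κ.range := ⟨κ x, κ.mem_range_self x⟩ with hi
  have hm : Measurable fun y => ‖u y - u x‖ₑ ^ b := (hu.sub_const _).enorm.pow_const b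
  calc ‖u x - d i‖ₑ ^ b ≤ ‖u x - c i‖ₑ ^ b + ‖c i - d i‖ₑ ^ b := enorm_sub_rpow_le hb hb1 _ _ _
    _ ≤ (2 * (2 ^ Module.finrank ℝ E *
          ∫⁻ h, ‖u (x + h) - u x‖ₑ ^ b ∂μ[|Metric.ball 0 (2 * δ)]) + η) + η := by
        refine add_le_add ((hc i (u x)).trans ?_) (hd i).le
        gcongr
        exact lintegral_cond_ball_le μ hm (hκ x hx)
    _ = _ := by ring

/-- A bounded set with uniformly small tails and uniform mean continuity is totally bounded: the
step functions on a compact set with values in a finite net form a finite `ε`-net of it. -/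
theorem IsPower.totallyBounded {n : ℕ}
    {ρ : FunctionQuasiNorm (volume : Measure (EuclideanSpace ℝ (Fin n)))} (hρ : ρ.IsPower)
    {K : Set ρ.space} (hbdd : ρ.IsBoundedIn K) (htail : ρ.HasUniformlySmallTails K)
    (hcont : ρ.IsUniformlyMeanContinuous K) : TotallyBounded K := by
  obtain ⟨b, σ, c₁, c₂, hb, hb1, hσ, heq⟩ := hρ.exists_rpow_equiv
  refine ρ.hasBasis_uniformity.totallyBounded_iff.2 fun ε hε => ?_
  obtain ⟨ε', hε', hlt⟩ := ENNReal.exists_forall_lt_mul_rpow_lt c₁ one_pos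
    (η := ε ^ b) (ENNReal.rpow_pos_of_nonneg hε hb.le)
  simp only [ENNReal.rpow_one] at hlt
  -- The error splits into three parts, each of which is kept below `ε' / 3`.
  have hθ : 0 < ε' / 3 := ENNReal.div_pos hε'.ne' (by simp)
  -- `D` is the constant in front of the mean oscillation in `exists_step_approximation`.
  set D : ℝ≥0 := 2 * 2 ^ Module.finrank ℝ (EuclideanSpace ℝ (Fin n)) with hD
  obtain ⟨r₁, hr₁, htail_lt⟩ := ENNReal.exists_forall_lt_mul_rpow_lt c₂ hb hθ
  obtain ⟨r₂, hr₂, hosc_lt⟩ := ENNReal.exists_forall_lt_mul_rpow_lt (D * c₂) hb hθ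
  obtain ⟨s₁, hs₁, hs₁r⟩ := ENNReal.lt_iff_exists_nnreal_btwn.1 hr₁
  obtain ⟨s₂, hs₂, hs₂r⟩ := ENNReal.lt_iff_exists_nnreal_btwn.1 hr₂
  obtain ⟨G, hG, hGu⟩ := htail s₁ (by exact_mod_cast hs₁)
  obtain ⟨δ', hδ', hcont'⟩ := hcont s₂ (by exact_mod_cast hs₂)
  obtain ⟨M, hM⟩ := hbdd
  have hGm : MeasurableSet G := hG.measurableSet
  have hχ : AEMeasurable (G.indicator fun _ => (1 : ℝ≥0∞)) volume :=
    aemeasurable_const.indicator hGm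
  have hGfin : σ.toFun (G.indicator fun _ => 1) < ∞ :=
    σ.indicator_lt_top' G hGm.nullMeasurableSet hG.measure_lt_top
  obtain ⟨η', hη', hχ_lt⟩ := ENNReal.exists_forall_lt_mul_rpow_lt
    (2 * (σ.toFun (G.indicator fun _ => 1)).toNNReal) one_pos hθ
  obtain ⟨η, hη, hηη⟩ := ENNReal.lt_iff_exists_nnreal_btwn.1 hη'
  -- The mean oscillation over balls of radius `2 * δ` has to be small.
  obtain ⟨δ, hδ, hδ2⟩ : ∃ δ : ℝ, 0 < δ ∧ 2 * δ = δ' := ⟨δ' / 2, half_pos hδ', by ring⟩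
  -- Since `σ` dominates integrals over sets of finite measure, the functions `|u|^b`, `u ∈ K`,
  -- are bounded in `L¹` of every ball.
  have hloc : ∀ (z : EuclideanSpace ℝ (Fin n)) (r : ℝ), ∃ R : ℝ≥0∞, R ≠ ∞ ∧ ∀ u ∈ K,
      ∫⁻ y in Metric.ball z r,
        ‖(u : EuclideanSpace ℝ (Fin n) →ₘ[volume] ℂ) y‖ₑ ^ b ≤ R := fun z r => by
    obtain ⟨c, -, hc⟩ := hσ.2 (Metric.ball z r)
      Metric.isOpen_ball.measurableSet.nullMeasurableSet measure_ball_lt_top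
    refine ⟨c * (c₂ * (M : ℝ≥0∞) ^ b), ?_, fun u hu => ?_⟩
    · exact ENNReal.mul_ne_top ENNReal.coe_ne_top (ENNReal.mul_ne_top ENNReal.coe_ne_top
        (ENNReal.rpow_ne_top_of_nonneg hb.le ENNReal.coe_ne_top))
    · refine (hc _ ((aemeasurable_enorm_coe _).pow_const b)).trans ?_
      gcongr
      refine (heq _ (aemeasurable_enorm_coe _)).2.trans ?_
      gcongr
      exact hM u hu
  choose R hR hRu using hloc
  obtain ⟨κ, hκ⟩ := hG.exists_simpleFunc_dist_lt hδ
  -- `S` bounds the means of `|u|^b` over the balls of the cover, uniformly in `u ∈ K`.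
  set S : ℝ≥0∞ := ∑ z ∈ κ.range, (volume (Metric.ball z δ))⁻¹ * R z δ with hS
  have hSfin : S ≠ ∞ := ENNReal.sum_ne_top.2 fun z _ => ENNReal.mul_ne_top
    (ENNReal.inv_ne_top.2 (Metric.measure_ball_pos volume z hδ).ne') (hR z δ)
  obtain ⟨T, hT, hTnet⟩ := exists_finite_net_enorm_rpow hb (R := 2 * S + η) (η := η)
    (by finiteness) hη
  have hTfin : (Set.univ.pi fun _ : κ.range => T).Finite := Set.Finite.pi fun _ => hT
  refine ⟨(ρ.stepFunction hG κ) '' (Set.univ.pi fun _ => T), hTfin.image _, fun u hu => ?_⟩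
  set w : EuclideanSpace ℝ (Fin n) → ℂ :=
    ((u : EuclideanSpace ℝ (Fin n) →ₘ[volume] ℂ) : EuclideanSpace ℝ (Fin n) → ℂ) with hw
  have hwm : Measurable w := (AEEqFun.stronglyMeasurable _).measurable
  set g : EuclideanSpace ℝ (Fin n) → ℝ≥0∞ := fun x =>
    ∫⁻ h, ‖w (x + h) - w x‖ₑ ^ b ∂volume[|Metric.ball 0 (2 * δ)] with hg
  have := isProbabilityMeasure_cond_ball volume (0 : EuclideanSpace ℝ (Fin n))
    (mul_pos two_pos hδ)
  have hgm : Measurable g := Measurable.lintegral_prod_right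
    (((hwm.comp (measurable_fst.add measurable_snd)).sub
      (hwm.comp measurable_fst)).enorm.pow_const b)
  have hosc : σ.toFun g ≤ c₂ * (s₂ : ℝ≥0∞) ^ b := by
    refine hσ.toFun_mean_oscillation_le hwm hb hb1 (mul_pos two_pos hδ)
      (fun x => (hRu x (2 * δ) u hu).trans_lt (hR x (2 * δ)).lt_top) fun h hh => ?_
    refine (heq _ ((hwm.comp (measurable_add_const h)).sub hwm).enorm.aemeasurable).2.trans ?_
    gcongr
    exact (hcont' u hu h (hδ2 ▸ hh)).le
  have htailu : σ.toFun (fun x => ‖Gᶜ.indicator w x‖ₑ ^ b) < ε' / 3 :=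
    (heq _ (hwm.indicator hGm.compl).enorm.aemeasurable).2.trans_lt
      (htail_lt _ ((hGu u hu).trans hs₁r))
  obtain ⟨d, hdT, hd⟩ := exists_step_approximation hwm hb hb1 hδ hκ hSfin hη
    (fun z hz => by
      rw [lintegral_cond]
      refine le_trans ?_ (Finset.single_le_sum (f := fun z => (volume (Metric.ball z δ))⁻¹ * R z δ)
        (fun _ _ => zero_le) hz)
      gcongr
      exact hRu z δ u hu) hTnet
  refine Set.mem_iUnion₂.2 ⟨_, ⟨d, fun i _ => hdT i, rfl⟩, ?_⟩
  change ρ.qnorm ((u - ρ.stepFunction hG κ d : ρ.space) : _ →ₘ[volume] ℂ) < ε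
  rw [qnorm_coe_sub, ← ENNReal.rpow_lt_rpow_iff hb]
  refine (heq _ (aemeasurable_enorm_coe_sub _ _)).1.trans_lt (hlt _ ?_)
  have hm₁ : AEMeasurable (fun x => ‖Gᶜ.indicator w x‖ₑ ^ b) volume :=
    ((hwm.indicator hGm.compl).enorm.pow_const b).aemeasurable
  have hm₂ : AEMeasurable (fun x => ((2 * η : ℝ≥0) : ℝ≥0∞) * G.indicator (fun _ => 1) x) volume :=
    hχ.const_mul _
  have hm₃ : AEMeasurable (fun x => (D : ℝ≥0∞) * g x) volume := hgm.aemeasurable.const_mul _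
  calc σ.toFun (fun x => ‖w x - (ρ.stepFunction hG κ d : _ →ₘ[volume] ℂ) x‖ₑ ^ b)
      ≤ σ.toFun (fun x => ‖Gᶜ.indicator w x‖ₑ ^ b
          + ((2 * η : ℝ≥0) : ℝ≥0∞) * G.indicator (fun _ => 1) x + D * g x) := by
        refine σ.mono' _ _ ((hm₁.add hm₂).add hm₃)
          ((aemeasurable_enorm_coe_sub _ _).pow_const b) ?_
        filter_upwards [ρ.coeFn_stepFunction hG κ d] with x hx
        rw [hx]
        by_cases hxG : x ∈ G
        · have hxc : x ∉ Gᶜ := fun h => h hxG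
          simp only [Set.indicator_of_mem hxG, Set.indicator_of_notMem hxc, enorm_zero,
            ENNReal.zero_rpow_of_pos hb, zero_add, mul_one]
          simpa [hD, hg] using hd x hxG
        · have hxc : x ∈ Gᶜ := hxG
          simp only [Set.indicator_of_notMem hxG, Set.indicator_of_mem hxc, sub_zero, mul_zero,
            add_zero]
          exact le_self_add
    _ ≤ σ.toFun (fun x => ‖Gᶜ.indicator w x‖ₑ ^ b)
          + ((2 * η : ℝ≥0) : ℝ≥0∞) * σ.toFun (G.indicator fun _ => 1) + D * σ.toFun g := by
        rw [← σ.smul' _ _ hχ, ← σ.smul' _ _ hgm.aemeasurable]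
        exact (hσ.toFun_add_le (hm₁.add hm₂) hm₃).trans
          (add_le_add (hσ.toFun_add_le hm₁ hm₂) le_rfl)
    _ < ε' / 3 + ε' / 3 + ε' / 3 := by
        refine ENNReal.add_lt_add (ENNReal.add_lt_add htailu ?_) ?_
        · have := hχ_lt η hηη
          rw [ENNReal.rpow_one, ENNReal.coe_mul, ENNReal.coe_toNNReal hGfin.ne] at this
          refine lt_of_eq_of_lt ?_ this
          push_cast
          ring
        · refine lt_of_le_of_lt ?_ (hosc_lt s₂ hs₂r)
          rw [ENNReal.coe_mul D c₂, mul_assoc (D : ℝ≥0∞)]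
          gcongr
    _ = ε' := ENNReal.add_thirds ε'

end FunctionQuasiNorm

theorem mainTheorem2 (n : ℕ)
    (ρ : FunctionQuasiNorm (volume : Measure (EuclideanSpace ℝ (Fin n)))) (hρ : ρ.IsPower) :
    ((∃ σ : FunctionQuasiNorm (volume : Measure (EuclideanSpace ℝ (Fin n))),
        σ.IsRearrangementInvariant ∧ ρ.Coincides σ) →
      ∀ K : Set ρ.space, K ⊆ closure ρ.compactlySupported → ρ.IsPrecompactIn K →
        ρ.IsBoundedIn K ∧ ρ.HasUniformlySmallTails K ∧ ρ.IsUniformlyMeanContinuous K) ∧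
    (∀ K : Set ρ.space, K ⊆ ρ.acPart →
      ρ.IsBoundedIn K → ρ.HasUniformlySmallTails K → ρ.IsUniformlyMeanContinuous K →
        ρ.IsPrecompactIn K) := by
  refine ⟨?_, ?_⟩
  · rintro ⟨σ, hσ, hρσ⟩ K hS hK
    have htb : TotallyBounded K := hK.totallyBounded.subset subset_closure
    exact ⟨ρ.isBoundedIn_of_totallyBounded htb, ρ.hasUniformlySmallTails_of_totallyBounded htb hS,
      FunctionQuasiNorm.isUniformlyMeanContinuous_of_totallyBounded hσ hρσ htb hS⟩
  · intro K _ hbdd htail hcont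
    have := hρ.completeSpace
    exact (hρ.totallyBounded hbdd htail hcont).closure.isCompact_of_isClosed isClosed_closure
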